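/- **Setting.** Let $d\ge 2$, let $B\subset\mathbb R^d$ be a nonempty, closed, bounded, convex and origin-symmetric set, and let $\|x\|_B=\inf\{t>0: x\in tB\}$ (with $\inf\emptyset=\infty$); let $\varepsilon\ge 0$. For $\mu\in\mathbb R^d$ and a positive definite $\Sigma\in\mathbb R^{d\times d}$, let $P_{\mu,\Sigma}$ be the law of $(x,y)$, where $y$ is uniform on $\{-1,+1\}$ and $x\mid y\sim\mathcal N(y\mu,\Sigma)$. For a measurable classifier $f:\mathbb R^d\to\{-1,+1\}$ put $$R^{B,\varepsilon}_{\mu,\Sigma}(f)=P_{\mu,\Sigma}\big(\exists\,\delta:\ \|\delta\|_B\le\varepsilon,\ f(x+\delta)\ne y\big),\qquad R^{B,\varepsilon}_{\mu,\Sigma}{}^{*}=\inf_f R^{B,\varepsilon}_{\mu,\Sigma}(f).$$ With $\|v\|_{\Sigma^{-1}}=\sqrt{v^T\Sigma^{-1}v}$ and $z_\Sigma(\mu)=\operatorname{argmin}_{\|z\|_B\le\varepsilon}\|\mu-z\|_{\Sigma^{-1}}^2$, let $$\mathrm{AdvSNR}_{B,\varepsilon}(\mu,\Sigma)=2\|\mu-z_\Sigma(\mu)\|_{\Sigma^{-1}},\qquad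 D_{B,\varepsilon}(r)=\{(\mu,\Sigma):\ \Sigma\succ0,\ \mathrm{AdvSNR}_{B,\varepsilon}(\mu,\Sigma)=r\}.$$ An estimator based on $n$ samples is a jointly measurable map $\widehat f$ that assigns a classifier to $n$ pairs $(x_1,y_1),\dots,(x_n,y_n)$. **Theorem.** The minimax robust excess risk over $D_{B,\varepsilon}(r)$ is at least $\Omega_P\big(e^{-(\frac18+o(1))r^2}\frac dn\big)$, for $r$ bounded away from $0$, where $o(1)$ is as $r\to\infty$. Precisely: there is a universal function $\eta:\mathbb R\to\mathbb R$ with $\eta(r)\to0$ as $r\to\infty$ such that, for every $r_0>0$ and every $\alpha>0$, there is a constant $c>0$ depending only on $r_0$ and $\alpha$ with the following property. For all integers $d\ge2$ and $n\ge d$, every $B$ and $\varepsilon$ as above, every $r\ge r_0$, and every estimator $\widehat f$ based on $n$ samples, there is $(\mu,\Sigma)\in D_{B,\varepsilon}(r)$ such that, when $(x_1,y_1),\dots,(x_n,y_n)$ are i.i.d. from $P_{\mu,\Sigma}$, $$\Pr\Big(R^{B,\varepsilon}_{\mu,\Sigma}(\widehat f)-R^{B,\varepsilon}_{\mu,\Sigma}{}^{*}\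 <\ c\,e^{-(\frac18+\eta(r))r^2}\,\frac dn\Big)\ \le\ \alpha .$$ -/

import Mathlib

open MeasureTheory ProbabilityTheory Filter Topology
open scoped ENNReal Pointwise Matrix

namespace AdvRobust

noncomputable section

/-- The feature space `ℝ^d`. -/
abbrev Vec (d : ℕ) : Type := EuclideanSpace ℝ (Fin d)

/-- The labels `{-1, +1}`, as the units of `ℤ`. -/
abbrev Label : Type := ℤˣ

/-- `‖x‖_A = √(xᵀ A x)`. -/
def matNorm {d : ℕ} (A : Matrix (Fin d) (Fin d) ℝ) (x : Vec d) : ℝ :=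
  Real.sqrt (x.ofLp ⬝ᵥ (A *ᵥ x.ofLp))

/-- The Minkowski functional `‖x‖_B = inf {t > 0 | x ∈ t B}`; it is `∞` when there is no such `t`
(so `B` may have empty interior). -/
def minkowski {d : ℕ} (B : Set (Vec d)) (x : Vec d) : ℝ≥0∞ :=
  ⨅ (t : ℝ) (_ : 0 < t) (_ : x ∈ t • B), ENNReal.ofReal t

/-- The perturbations `{δ | ‖δ‖_B ≤ ε}` available to the adversary. -/
def perturbations {d : ℕ} (B : Set (Vec d)) (ε : ℝ) : Set (Vec d) :=
  {x | minkowski B x ≤ ENNReal.ofReal ε}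

/-- The conditional Gaussian model `P_{μ,Σ}` of a pair `(x, y)`: the label `y` is uniform on
`{-1, +1}` and, given `y`, the feature `x` has law `N(y μ, Σ)`. -/
def model {d : ℕ} (μ : Vec d) (S : Matrix (Fin d) (Fin d) ℝ) : Measure (Vec d × Label) :=
  (2⁻¹ : ℝ≥0∞) • ((multivariateGaussian μ S).prod (Measure.dirac 1)) +
    (2⁻¹ : ℝ≥0∞) • ((multivariateGaussian (-μ) S).prod (Measure.dirac (-1)))

/-- The law of `n` i.i.d. samples from `P_{μ,Σ}`. -/
def sampleLaw {d : ℕ} (n : ℕ) (μ : Vec d) (S : Matrix (Fin d) (Fin d) ℝ) :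
    Measure (Fin n → Vec d × Label) :=
  Measure.pi fun _ => model μ S

/-- The robust classification error of the classifier `f`: the probability that some admissible
perturbation of `x` is not classified as `y`. -/
def robustRisk {d : ℕ} (B : Set (Vec d)) (ε : ℝ) (μ : Vec d) (S : Matrix (Fin d) (Fin d) ℝ)
    (f : Vec d → Label) : ℝ :=
  (model μ S).real {p | ∃ δ ∈ perturbations B ε, f (p.1 + δ) ≠ p.2}

/-- The optimal robust classification error, over all (measurable) classifiers. -/
def optimalRisk {d : ℕ} (B : Set (Vec d)) (ε : ℝ) (μ : Vec d)
    (S : Matrix (Fin d) (Fin d) ℝ) : ℝ :=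
  ⨅ f : {f : Vec d → Label // Measurable f}, robustRisk B ε μ S f

/-- The robust excess risk of the classifier `f`. -/
def excessRisk {d : ℕ} (B : Set (Vec d)) (ε : ℝ) (μ : Vec d) (S : Matrix (Fin d) (Fin d) ℝ)
    (f : Vec d → Label) : ℝ :=
  robustRisk B ε μ S f - optimalRisk B ε μ S

/-- `z_Σ(μ) = argmin_{‖z‖_B ≤ ε} ‖μ - z‖²_{Σ⁻¹}`. For `Σ` positive definite, `ε ≥ 0` and `B`
nonempty, compact, convex and symmetric, there is exactly one minimizer. -/
def zOpt {d : ℕ} (B : Set (Vec d)) (ε : ℝ) (μ : Vec d) (S : Matrix (Fin d) (Fin d) ℝ) : Vec d :=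
  Classical.epsilon fun z =>
    z ∈ perturbations B ε ∧ IsMinOn (fun z' => matNorm S⁻¹ (μ - z') ^ 2) (perturbations B ε) z

/-- The adversarial signal-to-noise ratio `2 ‖μ - z_Σ(μ)‖_{Σ⁻¹}`. -/
def advSNR {d : ℕ} (B : Set (Vec d)) (ε : ℝ) (μ : Vec d) (S : Matrix (Fin d) (Fin d) ℝ) : ℝ :=
  2 * matNorm S⁻¹ (μ - zOpt B ε μ S)

/-- The class `D_{B,ε}(r)` of the parameters with adversarial signal-to-noise ratio `r`. -/
def modelClass {d : ℕ} (B : Set (Vec d)) (ε r : ℝ) :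
    Set (Vec d × Matrix (Fin d) (Fin d) ℝ) :=
  {θ | θ.2.PosDef ∧ advSNR B ε θ.1 θ.2 = r}

end

end AdvRobust

namespace AdvRobust
open scoped RealInnerProductSpace

/-! The adversary can be made negligible. With covariance `s² I` and `s` huge compared with the
bounded perturbation set, rescaling by `s` leaves an isotropic model attacked within a tiny radius
`τ`, so robust and ordinary excess risks differ by at most `τ`. In each direction `u`, a length
within `τ` of `m = r / 2` makes the AdvSNR exactly `r` (`exists_mem_modelClass`).

What remains is a lower bound for classifying `N(±θ, I)` with `‖θ‖ ≈ m`. The Bayes classifiers of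
directions `u`, `v` disagree on a wedge of Gaussian mass at least of order `‖u - v‖`, where a wrong
label costs of order `m e^{-m²/2} ‖u - v‖`. Hence no classifier has excess risk much below `m
e^{-m²/2} ‖u - v‖²` for both (`isoRisk_add_isoRisk_ge`); here `e^{-m²/2} = e^{-r²/8}`.

Directions are packed in a spherical cap of radius of order `√(d/n) / (1 + m)`, so that `n` samples
have second-moment likelihood ratio at most `e^{d-1}` against the centre. The events "the estimator
is good for `u`" are disjoint, so one of `M` has probability at most `1/M` under the central law
and, by Cauchy–Schwarz, at most `√(e^{d-1}/M)` under its own. The packing makes `M` exponentially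
large in `d - 1`. -/

/-- The density of `N(h, I)` with respect to `N(0, I)`. -/
noncomputable def tilt {ι : Type*} [Fintype ι] (h x : EuclideanSpace ℝ ι) : ℝ :=
  Real.exp (⟪h, x⟫ - ‖h‖ ^ 2 / 2)

/-! ### Gaussian shifts and their densities. -/

section CameronMartin

variable {ι : Type*} [Fintype ι]

lemma tilt_pos (h x : EuclideanSpace ℝ ι) : 0 < tilt h x := Real.exp_pos _

lemma measurable_tilt (h : EuclideanSpace ℝ ι) : Measurable (tilt h) := by
  unfold tilt; fun_prop

/-- Complex exponents serve two uses: `z = h` gives the total mass of `tilt h`, and `z = h + i t`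
its characteristic function. -/
lemma integral_cexp_pi_gaussianReal (z : ι → ℂ) :
    ∫ x : ι → ℝ, Complex.exp (∑ i, z i * x i) ∂(Measure.pi fun _ => gaussianReal 0 1) =
      Complex.exp (∑ i, z i ^ 2 / 2) := by
  simp_rw [Complex.exp_sum]
  rw [integral_fintype_prod_eq_prod (f := fun i (x : ℝ) => Complex.exp (z i * x))]
  refine Finset.prod_congr rfl fun i _ => ?_
  have := complexMGF_id_gaussianReal (μ := 0) (v := 1) (z i)
  simp only [complexMGF, id] at this
  rw [this]; simp

lemma lintegral_tilt (h : EuclideanSpace ℝ ι) :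
    ∫⁻ x, ENNReal.ofReal (tilt h x) ∂(stdGaussian (EuclideanSpace ℝ ι)) = 1 := by
  rw [← map_pi_eq_stdGaussian, lintegral_map (by have := measurable_tilt h; fun_prop) (by fun_prop)]
  have h1 := integral_cexp_pi_gaussianReal (fun i => ((h i : ℝ) : ℂ))
  have h2 : ∀ x : ι → ℝ, Complex.exp (∑ i, ((h i : ℝ) : ℂ) * x i) =
      ((Real.exp (∑ i, h i * x i) : ℝ) : ℂ) := by intro x; push_cast; rfl
  simp_rw [h2] at h1
  rw [integral_complex_ofReal] at h1
  have h3 : ∫ x : ι → ℝ, Real.exp (∑ i, h i * x i) ∂(Measure.pi fun _ => gaussianReal 0 1) =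
      Real.exp (‖h‖ ^ 2 / 2) := by
    have : (Complex.exp (∑ i, ((h i : ℝ) : ℂ) ^ 2 / 2)) = ((Real.exp (‖h‖ ^ 2 / 2) : ℝ) : ℂ) := by
      rw [EuclideanSpace.real_norm_sq_eq, Finset.sum_div]; push_cast; rfl
    rw [this] at h1
    exact_mod_cast h1
  have h4 : Integrable (fun x : ι → ℝ => Real.exp (∑ i, h i * x i))
      (Measure.pi fun _ => gaussianReal 0 1) := by
    -- A non-integrable function has Bochner integral `0`, while `h3` gives a positive value.
    by_contra hc
    rw [integral_undef hc] at h3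
    exact (Real.exp_pos _).ne h3
  have h5 : ∀ x : ι → ℝ, tilt h (WithLp.toLp 2 x) =
      Real.exp (-(‖h‖ ^ 2 / 2)) * Real.exp (∑ i, h i * x i) := by
    intro x
    rw [tilt, ← Real.exp_add, PiLp.inner_apply]
    congr 1
    simp [mul_comm]; ring
  simp_rw [h5]
  rw [← ofReal_integral_eq_lintegral_ofReal (h4.const_mul _) (ae_of_all _ fun x => by positivity),
    integral_const_mul, h3, ← Real.exp_add]
  simp

/-- The Cameron–Martin formula in finite dimension. -/
theorem map_add_stdGaussian (h : EuclideanSpace ℝ ι) :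
    (stdGaussian (EuclideanSpace ℝ ι)).map (fun x => h + x) =
      (stdGaussian (EuclideanSpace ℝ ι)).withDensity fun x => ENNReal.ofReal (tilt h x) := by
  have hm := measurable_tilt h
  have : IsProbabilityMeasure ((stdGaussian (EuclideanSpace ℝ ι)).map (fun x => h + x)) :=
    Measure.isProbabilityMeasure_map (by fun_prop)
  have : IsFiniteMeasure ((stdGaussian (EuclideanSpace ℝ ι)).withDensity
      fun x => ENNReal.ofReal (tilt h x)) :=
    isFiniteMeasure_withDensity (by rw [lintegral_tilt]; simp)
  apply Measure.ext_of_charFun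
  ext t
  have hl : charFun ((stdGaussian (EuclideanSpace ℝ ι)).map (fun x => h + x)) t =
      Complex.exp (⟪h, t⟫ * Complex.I) * Complex.exp (- ‖t‖ ^ 2 / 2) := by
    rw [← charFun_stdGaussian, charFun_apply, charFun_apply,
      integral_map (by fun_prop) (Measurable.aestronglyMeasurable (by fun_prop)),
      ← integral_const_mul]
    congr 1; ext x
    rw [inner_add_left, ← Complex.exp_add]; push_cast; ring_nf
  rw [hl, charFun_apply, integral_withDensity_eq_integral_toReal_smul (by fun_prop) (by simp)]
  rw [← map_pi_eq_stdGaussian, integral_map (by fun_prop)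
    (Measurable.aestronglyMeasurable (by fun_prop))]
  have h1 := integral_cexp_pi_gaussianReal (fun i => ((h i : ℝ) : ℂ) + (t i : ℝ) * Complex.I)
  have h5 : ∀ x : ι → ℝ, (ENNReal.ofReal (tilt h (WithLp.toLp 2 x))).toReal •
      Complex.exp (⟪WithLp.toLp 2 x, t⟫ * Complex.I) = Complex.exp (-(‖h‖ ^ 2 / 2)) *
        Complex.exp (∑ i, (((h i : ℝ) : ℂ) + (t i : ℝ) * Complex.I) * x i) := by
    intro x
    rw [ENNReal.toReal_ofReal (tilt_pos _ _).le, tilt, Complex.real_smul, Complex.ofReal_exp,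
      ← Complex.exp_add, ← Complex.exp_add, PiLp.inner_apply, PiLp.inner_apply]
    congr 1
    simp only [add_mul, Finset.sum_add_distrib]
    push_cast
    simp only [Finset.sum_mul, RCLike.inner_apply, conj_trivial]
    have e1 : ∑ i, (t i : ℂ) * Complex.I * x i = ∑ i, ((t i * x i : ℝ) : ℂ) * Complex.I :=
      Finset.sum_congr rfl fun i _ => by push_cast; ring
    have e2 : ∑ i, (h i : ℂ) * x i = ∑ i, ((x i * h i : ℝ) : ℂ) :=
      Finset.sum_congr rfl fun i _ => by push_cast; ring
    rw [e1, e2]; ring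
  simp_rw [h5]
  rw [integral_const_mul, h1, ← Complex.exp_add, ← Complex.exp_add]
  congr 1
  have e1 : ((‖h‖ : ℝ) : ℂ) ^ 2 = ∑ i, (h i : ℂ) ^ 2 := by
    rw [← Complex.ofReal_pow, EuclideanSpace.real_norm_sq_eq]; push_cast; rfl
  have e2 : ((‖t‖ : ℝ) : ℂ) ^ 2 = ∑ i, (t i : ℂ) ^ 2 := by
    rw [← Complex.ofReal_pow, EuclideanSpace.real_norm_sq_eq]; push_cast; rfl
  rw [e1, e2, PiLp.inner_apply]
  push_cast
  simp only [RCLike.inner_apply, conj_trivial, Finset.sum_mul, neg_div, Finset.sum_div,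
    ← Finset.sum_neg_distrib, ← Finset.sum_add_distrib]
  refine Finset.sum_congr rfl fun i _ => ?_
  push_cast
  ring_nf
  rw [Complex.I_sq]; ring

/-- A scaled isotropic Gaussian as the image of the standard one. -/
lemma multivariateGaussian_smul_one [DecidableEq ι] {s : ℝ} (hs : 0 < s)
    (θ : EuclideanSpace ℝ ι) :
    multivariateGaussian (s • θ) (s ^ 2 • (1 : Matrix ι ι ℝ)) =
      ((stdGaussian (EuclideanSpace ℝ ι)).map (fun x => θ + x)).map (fun x => s • x) := by
  open scoped MatrixOrder in
  have h : CFC.sqrt (s ^ 2 • (1 : Matrix ι ι ℝ)) = s • (1 : Matrix ι ι ℝ) := by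
    have h0 : (0 : Matrix ι ι ℝ) ≤ s • (1 : Matrix ι ι ℝ) :=
      (Matrix.PosSemidef.one.smul hs.le).nonneg
    rw [CFC.sqrt_eq_iff _ _ (Matrix.PosSemidef.one.smul (by positivity)).nonneg h0]
    simp [smul_smul, pow_two]
  rw [multivariateGaussian, h, Measure.map_map (by fun_prop) (by fun_prop)]
  congr 1
  ext x
  simp [map_smul]
end CameronMartin

/-! ### Second-moment (chi-square) comparison of measures. -/

section SqDom

/-- `(∫ f dP)² ≤ C ∫ f² dQ` for all nonnegative `f`: the density of `P` with respect to `Q` has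
second moment at most `C`. -/
def SqDom {X : Type*} [MeasurableSpace X] (C : ℝ≥0∞) (P Q : Measure X) : Prop :=
  ∀ f : X → ℝ≥0∞, Measurable f → (∫⁻ x, f x ∂P) ^ 2 ≤ C * ∫⁻ x, f x ^ 2 ∂Q

variable {X Y : Type*} [MeasurableSpace X] [MeasurableSpace Y]

lemma SqDom.map {C : ℝ≥0∞} {P Q : Measure X} (h : SqDom C P Q) {g : X → Y} (hg : Measurable g) :
    SqDom C (P.map g) (Q.map g) := by
  intro f hf
  rw [lintegral_map hf hg, lintegral_map (by fun_prop) hg]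
  exact h _ (hf.comp hg)

/-- By Tonelli: the first comparison applies to the inner integral as a function of `x`, the second
to each section. -/
lemma SqDom.prod {C D : ℝ≥0∞} {P Q : Measure X} {P' Q' : Measure Y} [SFinite P] [SFinite Q]
    [SFinite P'] [SFinite Q'] (h : SqDom C P Q) (h' : SqDom D P' Q') :
    SqDom (C * D) (P.prod P') (Q.prod Q') := by
  intro f hf
  rw [lintegral_prod _ hf.aemeasurable, lintegral_prod _ (by fun_prop)]
  refine (h _ hf.lintegral_prod_right').trans ?_
  rw [mul_assoc, ← lintegral_const_mul D (by fun_prop)]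
  exact mul_le_mul' le_rfl (lintegral_mono fun x => h' _ (hf.comp measurable_prodMk_left))

lemma SqDom.pi {C : ℝ≥0∞} {P Q : Measure X} [SigmaFinite P] [SigmaFinite Q] (h : SqDom C P Q)
    (n : ℕ) : SqDom (C ^ n) (Measure.pi fun _ : Fin n => P) (Measure.pi fun _ : Fin n => Q) := by
  induction n with
  | zero =>
    intro f hf
    rw [Measure.pi_of_empty _ (Fin.elim0 : Fin 0 → X), Measure.pi_of_empty _ (Fin.elim0 : Fin 0 → X),
      lintegral_dirac' _ hf, lintegral_dirac' _ (by fun_prop)]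
    simp
  | succ k ih =>
    have e (R : Measure X) [SigmaFinite R] : (Measure.pi fun _ : Fin (k + 1) => R) =
        (R.prod (Measure.pi fun _ : Fin k => R)).map
          (MeasurableEquiv.piFinSuccAbove (fun _ => X) 0).symm :=
      ((measurePreserving_piFinSuccAbove (fun _ : Fin (k + 1) => R) 0).symm).map_eq.symm
    rw [e P, e Q, pow_succ']
    exact (h.prod ih).map (MeasurableEquiv.measurable _)

/-- Convexity of the square: mixing with equal weights costs nothing. -/
lemma SqDom.mix {C : ℝ≥0∞} {P Q P' Q' : Measure X} (h : SqDom C P Q) (h' : SqDom C P' Q') :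
    SqDom C ((2⁻¹ : ℝ≥0∞) • P + (2⁻¹ : ℝ≥0∞) • P') ((2⁻¹ : ℝ≥0∞) • Q + (2⁻¹ : ℝ≥0∞) • Q') := by
  intro f hf
  simp only [lintegral_add_measure, lintegral_smul_measure, smul_eq_mul]
  have key (a b : ℝ≥0∞) : (2⁻¹ * a + 2⁻¹ * b) ^ 2 ≤ 2⁻¹ * a ^ 2 + 2⁻¹ * b ^ 2 := by
    have := ENNReal.rpow_arith_mean_le_arith_mean2_rpow 2⁻¹ 2⁻¹ a b (ENNReal.inv_two_add_inv_two)
      (p := 2) (by norm_num)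
    simpa using this
  refine (key _ _).trans ?_
  rw [mul_add, mul_left_comm C, mul_left_comm C]
  gcongr
  · exact h f hf
  · exact h' f hf

/-- Cauchy–Schwarz, with `(tilt h)² = e^{‖h‖²} tilt (2h)` and `tilt (2h)` of integral `1`. -/
lemma sqDom_gaussian_zero {ι : Type*} [Fintype ι] (h : EuclideanSpace ℝ ι) :
    SqDom (ENNReal.ofReal (Real.exp (‖h‖ ^ 2)))
      ((stdGaussian (EuclideanSpace ℝ ι)).map (fun x => h + x))
      (stdGaussian (EuclideanSpace ℝ ι)) := by
  intro f hf
  have hm := measurable_tilt h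
  rw [map_add_stdGaussian, lintegral_withDensity_eq_lintegral_mul _ (by fun_prop) hf]
  have := ENNReal.lintegral_mul_le_Lp_mul_Lq (stdGaussian (EuclideanSpace ℝ ι)) (p := 2) (q := 2)
    (by constructor <;> norm_num) (f := fun x => ENNReal.ofReal (tilt h x)) (g := f)
    (by fun_prop) (by fun_prop)
  have h2 : ∫⁻ x, ENNReal.ofReal (tilt h x) ^ (2 : ℝ) ∂(stdGaussian (EuclideanSpace ℝ ι)) =
      ENNReal.ofReal (Real.exp (‖h‖ ^ 2)) := by
    have e : ∀ x, ENNReal.ofReal (tilt h x) ^ (2 : ℝ) =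
        ENNReal.ofReal (Real.exp (‖h‖ ^ 2)) * ENNReal.ofReal (tilt ((2 : ℝ) • h) x) := by
      intro x
      rw [← ENNReal.ofReal_mul (by positivity), ENNReal.ofReal_rpow_of_pos (tilt_pos _ _)]
      simp only [tilt]
      rw [← Real.exp_mul, ← Real.exp_add, inner_smul_left, norm_smul]
      congr 2
      simp; ring
    have hm2 := measurable_tilt ((2 : ℝ) • h)
    simp_rw [e]
    rw [lintegral_const_mul _ (by fun_prop), lintegral_tilt, mul_one]
  rw [h2] at this
  calc _ ≤ _ := pow_le_pow_left₀ zero_le this 2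
    _ = _ := by
      rw [mul_pow, ← ENNReal.rpow_natCast, ← ENNReal.rpow_mul, ← ENNReal.rpow_natCast,
        ← ENNReal.rpow_mul]; norm_num

lemma sqDom_gaussian {ι : Type*} [Fintype ι] (h h₀ : EuclideanSpace ℝ ι) :
    SqDom (ENNReal.ofReal (Real.exp (‖h - h₀‖ ^ 2)))
      ((stdGaussian (EuclideanSpace ℝ ι)).map (fun x => h + x))
      ((stdGaussian (EuclideanSpace ℝ ι)).map (fun x => h₀ + x)) := by
  have := (sqDom_gaussian_zero (h - h₀)).map (measurable_const_add h₀)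
  rw [Measure.map_map (by fun_prop) (by fun_prop)] at this
  convert this using 2
  ext x; simp [← add_assoc]

/-- Among `M` disjoint events, one has small probability under its own law. -/
lemma exists_measure_le_of_pairwiseDisjoint {κ : Type*} {T : Finset κ} (hT : T.Nonempty)
    {C : ℝ≥0∞} {Q : Measure X} [IsProbabilityMeasure Q] {P : κ → Measure X}
    (hP : ∀ i ∈ T, SqDom C (P i) Q) {A : κ → Set X} (hA : ∀ i ∈ T, MeasurableSet (A i))
    (hd : (T : Set κ).PairwiseDisjoint A) :
    ∃ i ∈ T, (P i (A i)) ^ 2 ≤ C / T.card := by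
  have h1 : ∀ i ∈ T, (P i (A i)) ^ 2 ≤ C * Q (A i) := by
    intro i hi
    have := hP i hi ((A i).indicator fun _ => 1) (measurable_const.indicator (hA i hi))
    rw [lintegral_indicator (hA i hi)] at this
    have e : ∀ x, ((A i).indicator (fun _ => (1 : ℝ≥0∞)) x) ^ 2 =
        (A i).indicator (fun _ => (1 : ℝ≥0∞)) x := by
      intro x; by_cases hx : x ∈ A i <;> simp [hx]
    simp_rw [e] at this
    rw [lintegral_indicator (hA i hi)] at this
    simpa using this
  obtain ⟨i, hi, hle⟩ : ∃ i ∈ T, Q (A i) ≤ 1 / T.card := by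
    by_contra! hc
    have : ∑ i ∈ T, (1 / (T.card : ℝ≥0∞)) < ∑ i ∈ T, Q (A i) :=
      ENNReal.sum_lt_sum_of_nonempty hT hc
    rw [← measure_biUnion_finset hd hA] at this
    have h2 : ∑ i ∈ T, (1 / (T.card : ℝ≥0∞)) = 1 := by
      rw [Finset.sum_const, nsmul_eq_mul, one_div, ENNReal.mul_inv_cancel]
      · simpa using hT.ne_empty
      · simp
    rw [h2] at this
    exact absurd prob_le_one (not_le.2 this)
  refine ⟨i, hi, (h1 i hi).trans ?_⟩
  rw [div_eq_mul_inv]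
  gcongr
  simpa using hle

end SqDom

/-! ### Packing by volume. -/

section Packing

/-- A ball of radius `R` contains a `δ R`-separated set of at least `δ⁻ᵈ` points. -/
lemma exists_separated_finset {E : Type*} [NormedAddCommGroup E] [NormedSpace ℝ E]
    [FiniteDimensional ℝ E] {δ R : ℝ} (hδ : 0 < δ) (hR : 0 < R) :
    ∃ T : Finset E, (∀ w ∈ T, ‖w‖ ≤ R) ∧ (∀ v ∈ T, ∀ w ∈ T, v ≠ w → δ * R ≤ ‖v - w‖) ∧
      1 ≤ δ ^ Module.finrank ℝ E * T.card := by
  borelize E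
  set A := Metric.closedBall (0 : E) R
  set ε : NNReal := ⟨δ * R, by positivity⟩
  have hε : (ε : ℝ) = δ * R := rfl
  have hA : IsCompact A := isCompact_closedBall _ _
  have hfin : Metric.packingNumber ε A ≠ ⊤ := by
    have hε2 : ε / 2 ≠ 0 := by
      have : (0 : ℝ) < δ * R := by positivity
      have : ε ≠ 0 := fun h => by rw [h] at hε; simp at hε; simp [hδ.ne', hR.ne'] at hε
      simpa using this
    obtain ⟨N, -, hN, hcov⟩ := Metric.exists_finite_isCover_of_isCompact hε2 hA
    have h1 := Metric.packingNumber_two_mul_le_externalCoveringNumber (ε / 2) A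
    rw [mul_div_cancel₀ _ (two_ne_zero)] at h1
    exact ((h1.trans hcov.externalCoveringNumber_le_encard).trans_lt hN.encard_lt_top).ne
  set C := Metric.maximalSeparatedSet ε A
  have hCA : C ⊆ A := Metric.maximalSeparatedSet_subset
  have hCs : Metric.IsSeparated ε C := Metric.isSeparated_maximalSeparatedSet
  have hCc : Metric.IsCover ε A C := Metric.isCover_maximalSeparatedSet hfin
  have hCf : C.Finite := by
    rw [← Set.encard_ne_top_iff, Metric.encard_maximalSeparatedSet hfin]; exact hfin
  refine ⟨hCf.toFinset, fun w hw => ?_, fun v hv w hw hvw => ?_, ?_⟩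
  · simpa [A] using hCA (hCf.mem_toFinset.1 hw)
  · have : (ε : ℝ≥0∞) < edist v w := hCs (hCf.mem_toFinset.1 hv) (hCf.mem_toFinset.1 hw) hvw
    rw [edist_dist, dist_eq_norm, ← ENNReal.ofReal_coe_nnreal, hε] at this
    exact (ENNReal.ofReal_lt_ofReal_iff_of_nonneg (by positivity)).1 this |>.le
  · let μ : Measure E := Measure.addHaar
    -- By maximality the separated set is also a cover; comparing volumes, `μ A` cancels.
    have hcov : A ⊆ ⋃ w ∈ hCf.toFinset, Metric.closedBall w (δ * R) := by
      intro x hx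
      obtain ⟨w, hw, hxw⟩ := hCc hx
      simp only [Set.mem_iUnion]
      refine ⟨w, hCf.mem_toFinset.2 hw, ?_⟩
      rw [Metric.mem_closedBall]
      have h2 : edist x w ≤ ε := hxw
      rw [edist_dist, ← ENNReal.ofReal_coe_nnreal, hε] at h2
      exact (ENNReal.ofReal_le_ofReal_iff (by positivity)).1 h2
    have h1 := (measure_mono hcov).trans (measure_biUnion_finset_le (μ := μ) _ _)
    have h3 : ∀ w : E, μ (Metric.closedBall w (δ * R)) =
        ENNReal.ofReal (δ ^ Module.finrank ℝ E) * μ A := fun w =>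
      Measure.addHaar_closedBall_mul_of_pos μ w hδ R
    simp_rw [h3] at h1
    rw [Finset.sum_const, nsmul_eq_mul] at h1
    have hpos : μ A ≠ 0 := (Metric.measure_closedBall_pos μ 0 hR).ne'
    have hlt : μ A ≠ ⊤ := hA.measure_lt_top.ne
    rw [← mul_assoc] at h1
    have h4 : 1 ≤ (hCf.toFinset.card : ℝ≥0∞) * ENNReal.ofReal (δ ^ Module.finrank ℝ E) := by
      rw [← ENNReal.mul_le_mul_iff_left hpos hlt, one_mul]; exact h1
    rw [← ENNReal.ofReal_natCast, ← ENNReal.ofReal_mul (by positivity), ← ENNReal.ofReal_one,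
      ENNReal.ofReal_le_ofReal_iff (by positivity)] at h4
    linarith
end Packing

/-! ### Gaussian mass of a wedge. -/

section Wedge

variable {ι : Type*} [Fintype ι]

lemma map_inner_stdGaussian {a : EuclideanSpace ℝ ι} (ha : ‖a‖ = 1) :
    (stdGaussian (EuclideanSpace ℝ ι)).map (fun x => ⟪a, x⟫) = gaussianReal 0 1 := by
  have := IsGaussian.map_eq_gaussianReal (μ := stdGaussian (EuclideanSpace ℝ ι)) (innerSL ℝ a)
  rw [integral_strongDual_stdGaussian, variance_dual_stdGaussian, innerSL_apply_norm, ha] at this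
  simpa using this

lemma indepFun_inner_stdGaussian {a b : EuclideanSpace ℝ ι} (hab : ⟪a, b⟫ = 0) :
    IndepFun (fun x => ⟪a, x⟫) (fun x => ⟪b, x⟫) (stdGaussian (EuclideanSpace ℝ ι)) := by
  apply HasGaussianLaw.indepFun_of_covariance_eq_zero
  · constructor
    exact (inferInstance : IsGaussian ((stdGaussian (EuclideanSpace ℝ ι)).map
      ((innerSL ℝ a).prod (innerSL ℝ b))))
  · rw [← covarianceBilin_apply_eq_cov IsGaussian.memLp_two_id, covarianceBilin_stdGaussian]
    exact hab

lemma ofReal_le_gaussianReal_Icc {l u p : ℝ} (hlu : l ≤ u)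
    (hp : ∀ x ∈ Set.Icc l u, p ≤ gaussianPDFReal 0 1 x) :
    ENNReal.ofReal (p * (u - l)) ≤ gaussianReal 0 1 (Set.Icc l u) := by
  rw [gaussianReal_apply _ one_ne_zero, mul_comm, ENNReal.ofReal_mul (by linarith),
    ← Real.volume_Icc, mul_comm]
  calc ENNReal.ofReal p * volume (Set.Icc l u) = ∫⁻ x in Set.Icc l u, ENNReal.ofReal p := by simp
    _ ≤ _ := setLIntegral_mono (measurable_gaussianPDF _ _) fun x hx =>
      ENNReal.ofReal_le_ofReal (hp x hx)

lemma gaussianReal_Icc_le (l u : ℝ) :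
    gaussianReal 0 1 (Set.Icc l u) ≤ ENNReal.ofReal (u - l) := by
  rw [gaussianReal_apply _ one_ne_zero, ← Real.volume_Icc]
  calc _ ≤ ∫⁻ x in Set.Icc l u, 1 := setLIntegral_mono measurable_const fun x hx => ?_
    _ = _ := by simp
  rw [gaussianPDF, ENNReal.ofReal_le_one, gaussianPDFReal]
  have h1 : (√(2 * Real.pi * (1 : NNReal)))⁻¹ ≤ 1 := by
    apply inv_le_one_of_one_le₀
    rw [Real.one_le_sqrt]
    have := Real.pi_gt_three
    simp; linarith
  have h2 : Real.exp (-(x - 0) ^ 2 / (2 * (1 : NNReal))) ≤ 1 := by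
    rw [Real.exp_le_one_iff, neg_div]
    have : 0 ≤ (x - 0) ^ 2 / (2 * ((1 : NNReal) : ℝ)) := by positivity
    linarith
  exact mul_le_one₀ h1 (Real.exp_pos _).le h2

lemma gaussianPDFReal_anti {x y : ℝ} (h : |x| ≤ y) :
    gaussianPDFReal 0 1 y ≤ gaussianPDFReal 0 1 x := by
  simp only [gaussianPDFReal]
  gcongr 1
  rw [Real.exp_le_exp]
  have := sq_le_sq' (by linarith [neg_abs_le x, abs_nonneg x, neg_le_of_abs_le h]) ((le_abs_self x).trans h)
  simp; linarith

/-- The constant in `le_stdGaussian_wedge`. -/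
noncomputable def wedgeConst : ℝ := gaussianPDFReal 0 1 1 * gaussianPDFReal 0 1 2

lemma wedgeConst_pos : 0 < wedgeConst :=
  mul_pos (gaussianPDFReal_pos _ _ _ one_ne_zero) (gaussianPDFReal_pos _ _ _ one_ne_zero)

/-- The normalized coordinates along `a` and `b` are independent standard normals; one is kept in
`[-‖b‖/2, ‖b‖/2]`, the other in `[1, 2]`. On this set `⟪a + b, x⟫` and `⟪a - b, x⟫` have opposite
signs and size at least `‖b‖/2`. -/
lemma le_stdGaussian_wedge {a b : EuclideanSpace ℝ ι} (hab : ⟪a, b⟫ = 0) (ha : a ≠ 0)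
    (ha1 : ‖a‖ ≤ 1) (hb : b ≠ 0) (hb1 : ‖b‖ ≤ 1) :
    ENNReal.ofReal (wedgeConst * ‖b‖) ≤ stdGaussian (EuclideanSpace ℝ ι)
      {x | |⟪a, x⟫| ≤ ‖b‖ / 2 ∧ ‖b‖ ≤ ⟪b, x⟫} := by
  have hna : 0 < ‖a‖ := norm_pos_iff.2 ha
  have hnb : 0 < ‖b‖ := norm_pos_iff.2 hb
  set a' := ‖a‖⁻¹ • a
  set b' := ‖b‖⁻¹ • b
  have ha' : ‖a'‖ = 1 := norm_smul_inv_norm (𝕜 := ℝ) ha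
  have hb' : ‖b'‖ = 1 := norm_smul_inv_norm (𝕜 := ℝ) hb
  have hab' : ⟪a', b'⟫ = 0 := by simp [a', b', inner_smul_left, inner_smul_right, hab]
  have hind := (indepFun_inner_stdGaussian hab').measure_inter_preimage_eq_mul
    (Set.Icc (-(‖b‖ / 2)) (‖b‖ / 2)) (Set.Icc 1 2) measurableSet_Icc measurableSet_Icc
  rw [← Measure.map_apply (by fun_prop) measurableSet_Icc,
    ← Measure.map_apply (by fun_prop) measurableSet_Icc, map_inner_stdGaussian ha',
    map_inner_stdGaussian hb'] at hind
  have h1 := ofReal_le_gaussianReal_Icc (l := -(‖b‖ / 2)) (u := ‖b‖ / 2) (by linarith)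
    (p := gaussianPDFReal 0 1 1) fun x hx => gaussianPDFReal_anti (by
      rw [abs_le]; constructor <;> linarith [hx.1, hx.2])
  have h2 := ofReal_le_gaussianReal_Icc (l := 1) (u := 2) (by norm_num)
    (p := gaussianPDFReal 0 1 2) fun x hx => gaussianPDFReal_anti (by
      rw [abs_le]; constructor <;> linarith [hx.1, hx.2])
  calc ENNReal.ofReal (wedgeConst * ‖b‖)
      = ENNReal.ofReal (gaussianPDFReal 0 1 1 * (‖b‖ / 2 - -(‖b‖ / 2))) *
          ENNReal.ofReal (gaussianPDFReal 0 1 2 * (2 - 1)) := by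
        rw [← ENNReal.ofReal_mul
          (mul_nonneg (gaussianPDFReal_nonneg _ _ _) (by linarith)), wedgeConst]
        congr 1; ring
    _ ≤ _ := mul_le_mul' h1 h2
    _ = _ := hind.symm
    _ ≤ _ := by
      apply measure_mono
      rintro x ⟨hx1, hx2⟩
      have e1 : ⟪a, x⟫ = ‖a‖ * ⟪a', x⟫ := by
        simp [a', inner_smul_left, hna.ne']
      have e2 : ⟪b, x⟫ = ‖b‖ * ⟪b', x⟫ := by
        simp [b', inner_smul_left, hnb.ne']
      have h3 : |⟪a', x⟫| ≤ ‖b‖ / 2 := abs_le.2 hx1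
      refine ⟨?_, ?_⟩
      · rw [e1, abs_mul, abs_of_pos hna]
        nlinarith [abs_nonneg ⟪a', x⟫]
      · rw [e2]
        have : 1 ≤ ⟪b', x⟫ := hx2.1
        nlinarith

end Wedge

/-! ### The isotropic model and its classification risk. -/

instance : MeasurableSingletonClass Label :=
  ⟨fun u => ⟨{(u : ℤ)}, measurableSet_singleton _, by ext v; simp [Units.ext_iff]⟩⟩

/-- The law of `θ + z` with `z` standard Gaussian. -/
noncomputable def shiftedGaussian {d : ℕ} (θ : Vec d) : Measure (Vec d) :=
  (stdGaussian (Vec d)).map (fun x => θ + x)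

instance {d : ℕ} (θ : Vec d) : IsProbabilityMeasure (shiftedGaussian θ) :=
  Measure.isProbabilityMeasure_map (by fun_prop)

/-- The law of a labelled pair when the features have mean `±θ` and identity covariance. -/
noncomputable def isoModel {d : ℕ} (θ : Vec d) : Measure (Vec d × Label) :=
  (2⁻¹ : ℝ≥0∞) • ((shiftedGaussian θ).prod (Measure.dirac 1)) +
    (2⁻¹ : ℝ≥0∞) • ((shiftedGaussian (-θ)).prod (Measure.dirac (-1)))

/-- The misclassification probability under `isoModel`. -/
noncomputable def isoRisk {d : ℕ} (θ : Vec d) (g : Vec d → Label) : ℝ≥0∞ :=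
  isoModel θ {p | g p.1 ≠ p.2}

/-- The linear classifier with normal vector `θ`. -/
noncomputable def linClass {d : ℕ} (θ : Vec d) (x : Vec d) : Label :=
  if 0 ≤ ⟪θ, x⟫ then 1 else -1

variable {d : ℕ}

lemma measurable_linClass (θ : Vec d) : Measurable (linClass θ) :=
  Measurable.ite (measurableSet_le measurable_const (by fun_prop)) measurable_const measurable_const

lemma linClass_smul {a : ℝ} (ha : 0 < a) (θ x : Vec d) : linClass (a • θ) x = linClass θ x := by
  simp [linClass, inner_smul_left, ha]

lemma isoModel_apply (θ : Vec d) {E : Set (Vec d × Label)} (hE : MeasurableSet E) :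
    isoModel θ E = 2⁻¹ * shiftedGaussian θ {x | (x, 1) ∈ E} +
      2⁻¹ * shiftedGaussian (-θ) {x | (x, -1) ∈ E} := by
  simp only [isoModel, Measure.add_apply, Measure.smul_apply, smul_eq_mul, Measure.prod_dirac]
  rw [Measure.map_apply (by fun_prop) hE, Measure.map_apply (by fun_prop) hE]
  rfl

instance (θ : Vec d) : IsProbabilityMeasure (isoModel θ) :=
  ⟨by rw [isoModel_apply _ MeasurableSet.univ]; simp [ENNReal.inv_two_add_inv_two]⟩

lemma model_smul {s : ℝ} (hs : 0 < s) (θ : Vec d) :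
    model (s • θ) (s ^ 2 • (1 : Matrix (Fin d) (Fin d) ℝ)) =
      (isoModel θ).map (fun p => (s • p.1, p.2)) := by
  have key (μ : Vec d) (y : Label) : ((shiftedGaussian μ).map (fun x => s • x)).prod
      (Measure.dirac y) =
      ((shiftedGaussian μ).prod (Measure.dirac y)).map (fun p => (s • p.1, p.2)) := by
    rw [Measure.prod_dirac, Measure.prod_dirac, Measure.map_map (by fun_prop) (by fun_prop),
      Measure.map_map (by fun_prop) (by fun_prop)]
    rfl
  rw [model, isoModel, ← smul_neg, multivariateGaussian_smul_one hs,
    multivariateGaussian_smul_one hs, Measure.map_add _ _ (by fun_prop), Measure.map_smul,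
    Measure.map_smul, ← key, ← key]
  rfl

lemma isProbabilityMeasure_model_smul {s : ℝ} (hs : 0 < s) (θ : Vec d) :
    IsProbabilityMeasure (model (s • θ) (s ^ 2 • (1 : Matrix (Fin d) (Fin d) ℝ))) := by
  rw [model_smul hs]
  exact Measure.isProbabilityMeasure_map (by fun_prop)

lemma sqDom_isoModel (θ θ₀ : Vec d) :
    SqDom (ENNReal.ofReal (Real.exp (‖θ - θ₀‖ ^ 2))) (isoModel θ) (isoModel θ₀) := by
  simp only [isoModel, Measure.prod_dirac]
  refine ((sqDom_gaussian θ θ₀).map (by fun_prop)).mix (SqDom.map ?_ (by fun_prop))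
  have := sqDom_gaussian (-θ) (-θ₀)
  rwa [← neg_sub', norm_neg] at this

lemma isoRisk_eq_lintegral (θ : Vec d) {g : Vec d → Label} (hg : Measurable g) :
    isoRisk θ g = ∫⁻ x, (2⁻¹ * if g x = 1 then ENNReal.ofReal (tilt (-θ) x)
      else ENNReal.ofReal (tilt θ x)) ∂(stdGaussian (Vec d)) := by
  have h1 : MeasurableSet {x | g x = 1} := hg (measurableSet_singleton _)
  have hE : MeasurableSet {p : Vec d × Label | g p.1 ≠ p.2} :=
    (measurableSet_eq_fun (by fun_prop) (by fun_prop)).compl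
  have hm := measurable_tilt θ
  have hm' := measurable_tilt (-θ)
  rw [isoRisk, isoModel_apply _ hE]
  have e : {x : Vec d | (x, (-1 : Label)) ∈ {p : Vec d × Label | g p.1 ≠ p.2}} = {x | g x = 1} := by
    ext x
    rcases Int.units_eq_one_or (g x) with h | h <;> simp [h]
  have e' : {x : Vec d | (x, (1 : Label)) ∈ {p : Vec d × Label | g p.1 ≠ p.2}} =
    {x | g x = 1}ᶜ := rfl
  rw [e, e', shiftedGaussian, shiftedGaussian, map_add_stdGaussian, map_add_stdGaussian,
    withDensity_apply _ h1.compl, withDensity_apply _ h1, lintegral_const_mul _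
      (Measurable.ite h1 (by fun_prop) (by fun_prop)), ← mul_add,
    add_comm, ← lintegral_add_compl (μ := stdGaussian (Vec d)) (fun x => if g x = 1 then
      ENNReal.ofReal (tilt (-θ) x) else ENNReal.ofReal (tilt θ x)) h1]
  congr 2
  · exact setLIntegral_congr_fun h1 fun x hx => (if_pos hx).symm
  · exact setLIntegral_congr_fun h1.compl fun x hx => (if_neg hx).symm

/-- The difference equals `2 e^{-‖θ‖²/2} sinh ⟪θ, x⟫`, and `sinh t ≥ t` for `t ≥ 0`. -/
lemma two_mul_le_tilt_sub {θ x : Vec d} (h : 0 ≤ ⟪θ, x⟫) :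
    2 * (Real.exp (-(‖θ‖ ^ 2 / 2)) * ⟪θ, x⟫) ≤ tilt θ x - tilt (-θ) x := by
  have e1 : tilt θ x = Real.exp (-(‖θ‖ ^ 2 / 2)) * Real.exp ⟪θ, x⟫ := by
    rw [tilt, ← Real.exp_add]; ring_nf
  have e2 : tilt (-θ) x = Real.exp (-(‖θ‖ ^ 2 / 2)) * Real.exp (-⟪θ, x⟫) := by
    rw [tilt, ← Real.exp_add, inner_neg_left, norm_neg]; ring_nf
  have := Real.self_le_sinh_iff.2 h
  rw [Real.sinh_eq] at this
  rw [e1, e2, ← mul_sub]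
  nlinarith [Real.exp_pos (-(‖θ‖ ^ 2 / 2))]

/-- The excess risk of a classifier is at least the integral of `e^{-‖θ‖²/2} |⟪θ, x⟫|` over
the region where it disagrees with the Bayes classifier. -/
lemma isoRisk_linClass_add_le (θ : Vec d) {g : Vec d → Label} (hg : Measurable g) :
    isoRisk θ (linClass θ) + ∫⁻ x, (if g x = linClass θ x then 0 else
      ENNReal.ofReal (Real.exp (-(‖θ‖ ^ 2 / 2)) * |⟪θ, x⟫|)) ∂(stdGaussian (Vec d)) ≤
      isoRisk θ g := by
  have hm := measurable_tilt θ
  have hm' := measurable_tilt (-θ)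
  rw [isoRisk_eq_lintegral _ hg, isoRisk_eq_lintegral _ (measurable_linClass θ),
    ← lintegral_add_left]
  swap
  · exact (Measurable.ite (measurable_linClass θ (measurableSet_singleton _)) (by fun_prop)
      (by fun_prop)).const_mul _
  refine lintegral_mono fun x => ?_
  have key {a b c : ℝ} (ha : 0 < a) (hb : 0 ≤ b) (h : 2 * b ≤ c - a) :
      2⁻¹ * ENNReal.ofReal a + ENNReal.ofReal b ≤ 2⁻¹ * ENNReal.ofReal c := by
    have e : (2⁻¹ : ℝ≥0∞) = ENNReal.ofReal 2⁻¹ := by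
      rw [ENNReal.ofReal_inv_of_pos two_pos]; simp
    rw [e, ← ENNReal.ofReal_mul (by norm_num), ← ENNReal.ofReal_mul (by norm_num),
      ← ENNReal.ofReal_add (by positivity) hb]
    exact ENNReal.ofReal_le_ofReal (by linarith)
  by_cases h : g x = linClass θ x
  · simp [h]
  · simp only [if_neg h]
    by_cases hx : 0 ≤ ⟪θ, x⟫
    · have hl : linClass θ x = 1 := if_pos hx
      rw [hl] at h
      simp only [hl, if_true, if_neg h]
      rw [abs_of_nonneg hx]
      exact key (tilt_pos _ _) (by positivity) (two_mul_le_tilt_sub hx)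
    · have hl : linClass θ x = -1 := if_neg hx
      rw [hl] at h
      have hg1 : g x = 1 := (Int.units_eq_one_or (g x)).resolve_right h
      simp only [hl, hg1, if_true]
      rw [if_neg (by decide)]
      push Not at hx
      have := two_mul_le_tilt_sub (θ := -θ) (x := x) (by rw [inner_neg_left]; linarith)
      rw [neg_neg, inner_neg_left, norm_neg] at this
      rw [abs_of_neg hx]
      exact key (tilt_pos _ _) (mul_nonneg (Real.exp_pos _).le (by linarith)) this

/-- No classifier is nearly optimal for two well separated parameters at once. -/
lemma isoRisk_add_isoRisk_ge {u v : Vec d} (hu : ‖u‖ = 1) (hv : ‖v‖ = 1) (huv : u ≠ v)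
    (huv' : u + v ≠ 0) {m m' a b : ℝ} (hm : 0 < m) (ha : m ≤ a) (ha' : a ≤ m') (hb : m ≤ b)
    (hb' : b ≤ m') {g : Vec d → Label} (hg : Measurable g) :
    isoRisk (a • u) (linClass (a • u)) + isoRisk (b • v) (linClass (b • v)) +
      ENNReal.ofReal (Real.exp (-(m' ^ 2 / 2)) * m * (wedgeConst / 8) * ‖u - v‖ ^ 2) ≤
      isoRisk (a • u) g + isoRisk (b • v) g := by
  have h1 := isoRisk_linClass_add_le (a • u) hg
  have h2 := isoRisk_linClass_add_le (b • v) hg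
  have hcl := measurable_linClass (a • u)
  refine le_trans ?_ (add_le_add h1 h2)
  rw [add_add_add_comm]
  refine add_le_add le_rfl ?_
  have hms : Measurable fun x => if g x = linClass (a • u) x then 0 else
      ENNReal.ofReal (Real.exp (-(‖a • u‖ ^ 2 / 2)) * |⟪a • u, x⟫|) :=
    Measurable.ite (measurableSet_eq_fun hg hcl) (by fun_prop) (by fun_prop)
  rw [← lintegral_add_left hms]
  set p : Vec d := (2⁻¹ : ℝ) • (u + v) with hp
  set q : Vec d := (2⁻¹ : ℝ) • (u - v) with hq
  have hpu : p + q = u := by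
    rw [hp, hq, ← smul_add]; simp [← two_smul ℝ]
  have hpv : p - q = v := by
    rw [hp, hq, ← smul_sub]; simp [← two_smul ℝ]
  have hp0 : p ≠ 0 := smul_ne_zero (by norm_num) huv'
  have hq0 : q ≠ 0 := by simpa [hq, sub_eq_zero] using huv
  have hqn : ‖q‖ = ‖u - v‖ / 2 := by rw [hq, norm_smul]; norm_num; ring
  have hq1 : ‖q‖ ≤ 1 := by have := norm_sub_le u v; rw [hqn]; linarith
  have hp1 : ‖p‖ ≤ 1 := by
    have := norm_add_le u v; rw [hp, norm_smul]; norm_num; linarith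
  have hpq : ⟪p, q⟫ = 0 := by
    rw [hp, hq, inner_smul_left, inner_smul_right, real_inner_add_sub_eq_zero_iff u v |>.2
      (by rw [hu, hv])]; simp
  have hw := le_stdGaussian_wedge hpq hp0 hp1 hq0 hq1
  set W := {x | |⟪p, x⟫| ≤ ‖q‖ / 2 ∧ ‖q‖ ≤ ⟪q, x⟫} with hW
  have hWm : MeasurableSet W := by
    rw [hW]; measurability
  set t := Real.exp (-(m' ^ 2 / 2)) * (m * (‖q‖ / 2)) with ht
  -- On `W` the two Bayes classifiers give opposite labels, so any value of `g` disagrees with one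
  -- of them and pays at least `t`.
  have hpt : ∀ x ∈ W, ENNReal.ofReal t ≤
      (if g x = linClass (a • u) x then 0 else
        ENNReal.ofReal (Real.exp (-(‖a • u‖ ^ 2 / 2)) * |⟪a • u, x⟫|)) +
      (if g x = linClass (b • v) x then 0 else
        ENNReal.ofReal (Real.exp (-(‖b • v‖ ^ 2 / 2)) * |⟪b • v, x⟫|)) := by
    rintro x ⟨hx1, hx2⟩
    have hq' := norm_nonneg q
    rw [abs_le] at hx1
    have hxu : ‖q‖ / 2 ≤ ⟪u, x⟫ := by rw [← hpu, inner_add_left]; linarith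
    have hxv : ⟪v, x⟫ ≤ -(‖q‖ / 2) := by rw [← hpv, inner_sub_left]; linarith
    have hqpos : 0 < ‖q‖ := norm_pos_iff.2 hq0
    have hlu : linClass (a • u) x = 1 := by
      rw [linClass_smul (by linarith)]; exact if_pos (by linarith)
    have hlv : linClass (b • v) x = -1 := by
      rw [linClass_smul (by linarith)]; exact if_neg (by linarith)
    rw [hlu, hlv]
    have hbound {c : ℝ} {z : Vec d} (hz : ‖z‖ = 1) (hc : m ≤ c) (hc' : c ≤ m')
        (hzx : ‖q‖ / 2 ≤ |⟪z, x⟫|) :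
        ENNReal.ofReal t ≤ ENNReal.ofReal (Real.exp (-(‖c • z‖ ^ 2 / 2)) * |⟪c • z, x⟫|) := by
      have hc0 : 0 < c := by linarith
      rw [norm_smul, hz, mul_one, Real.norm_eq_abs, sq_abs, inner_smul_left, abs_mul]
      simp only [conj_trivial]
      rw [abs_of_pos hc0]
      apply ENNReal.ofReal_le_ofReal
      rw [ht]
      gcongr
    rcases Int.units_eq_one_or (g x) with h | h
    · rw [h, if_pos rfl, if_neg (by decide), zero_add]
      exact hbound hv hb hb' (by rw [abs_of_nonpos (by linarith)]; linarith)
    · rw [h, if_neg (by decide), if_pos rfl, add_zero]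
      exact hbound hu ha ha' (hxu.trans (le_abs_self _))
  calc ENNReal.ofReal (Real.exp (-(m' ^ 2 / 2)) * m * (wedgeConst / 8) * ‖u - v‖ ^ 2)
      = ENNReal.ofReal t * ENNReal.ofReal (wedgeConst * ‖q‖) := by
        rw [← ENNReal.ofReal_mul (by positivity), ht, hqn]; congr 1; ring
    _ ≤ ENNReal.ofReal t * stdGaussian (Vec d) W := by gcongr
    _ = ∫⁻ x in W, ENNReal.ofReal t ∂(stdGaussian (Vec d)) := by simp
    _ ≤ _ := setLIntegral_mono' hWm hpt
    _ ≤ _ := setLIntegral_le_lintegral _ _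


/-! ### Compactness of the perturbation set. -/

section Perturbations

variable {B : Set (Vec d)} {ε : ℝ}

lemma zero_mem_of_convex_of_symm (hne : B.Nonempty) (hc : Convex ℝ B)
    (hs : ∀ x ∈ B, -x ∈ B) : (0 : Vec d) ∈ B := by
  obtain ⟨x, hx⟩ := hne
  have := hc hx (hs x hx) (a := 1 / 2) (b := 1 / 2) (by norm_num) (by norm_num) (by norm_num)
  simpa using this

lemma zero_mem_perturbations (h0 : (0 : Vec d) ∈ B) : (0 : Vec d) ∈ perturbations B ε := by
  have : minkowski B (0 : Vec d) = 0 := by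
    refine le_antisymm (ENNReal.le_of_forall_pos_le_add fun t ht _ => ?_) zero_le
    rw [zero_add]
    refine (iInf₂_le (t : ℝ) (by exact_mod_cast ht)).trans ((iInf_le _ ?_).trans ?_)
    · exact ⟨0, h0, by simp⟩
    · simp
  simp [perturbations, this]

/-- The sets `t • B` increase with `t`, by convexity and `0 ∈ B`. Intersecting over `t > ε` avoids
asking whether the infimum is attained, and covers `ε = 0`. -/
lemma perturbations_eq_iInter (hc : Convex ℝ B) (h0 : (0 : Vec d) ∈ B) (hε : 0 ≤ ε) :
    perturbations B ε = ⋂ t ∈ Set.Ioi ε, t • B := by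
  ext x
  simp only [Set.mem_iInter, Set.mem_Ioi]
  constructor
  · intro hx t ht
    have h1 : minkowski B x < ENNReal.ofReal t :=
      lt_of_le_of_lt hx ((ENNReal.ofReal_lt_ofReal_iff (hε.trans_lt ht)).2 ht)
    simp only [minkowski, iInf_lt_iff] at h1
    obtain ⟨a, ha, ⟨y, hy, rfl⟩, hat⟩ := h1
    have hat' : a < t := (ENNReal.ofReal_lt_ofReal_iff (hε.trans_lt ht)).1 hat
    have ht0 : 0 < t := hε.trans_lt ht
    refine ⟨(a / t) • y, ?_, ?_⟩
    · exact hc.smul_mem_of_zero_mem h0 hy ⟨by positivity, (div_le_one ht0).2 hat'.le⟩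
    · simp only [smul_smul]; rw [mul_div_cancel₀ _ ht0.ne']
  · intro h
    refine ENNReal.le_of_forall_pos_le_add fun t ht _ => ?_
    have ht' : (0 : ℝ) < t := by exact_mod_cast ht
    have h1 := h (ε + t) (by linarith)
    have h2 : minkowski B x ≤ ENNReal.ofReal (ε + t) :=
      (iInf₂_le (ε + t) (by linarith)).trans (iInf_le _ h1)
    rw [ENNReal.ofReal_add hε ht'.le] at h2
    simpa using h2

lemma isCompact_perturbations (hcl : IsClosed B) (hb : Bornology.IsBounded B) (hc : Convex ℝ B)
    (h0 : (0 : Vec d) ∈ B) (hε : 0 ≤ ε) : IsCompact (perturbations B ε) := by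
  rw [perturbations_eq_iInter hc h0 hε]
  have hB : IsCompact B := Metric.isCompact_of_isClosed_isBounded hcl hb
  refine (hB.smul (ε + 1)).of_isClosed_subset ?_ (Set.iInter₂_subset (ε + 1) (by simp))
  exact isClosed_biInter fun t ht => (hB.smul t).isClosed

end Perturbations

/-! ### Isotropic members of the model class. -/

section ModelClass

lemma matNorm_inv_sq_smul_one {s : ℝ} (hs : 0 < s) (x : Vec d) :
    matNorm (s ^ 2 • (1 : Matrix (Fin d) (Fin d) ℝ))⁻¹ x = ‖x‖ / s := by
  have h1 : (s ^ 2 • (1 : Matrix (Fin d) (Fin d) ℝ))⁻¹ = (s ^ 2)⁻¹ • 1 := by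
    apply Matrix.inv_eq_right_inv
    rw [Matrix.smul_mul, Matrix.mul_smul, smul_smul, mul_inv_cancel₀ (by positivity)]
    simp
  have h2 : x.ofLp ⬝ᵥ x.ofLp = ‖x‖ ^ 2 := by
    rw [EuclideanSpace.real_norm_sq_eq]; simp [dotProduct, pow_two]
  rw [matNorm, h1, Matrix.smul_mulVec, Matrix.one_mulVec, dotProduct_smul, h2, smul_eq_mul,
    ← inv_pow, ← mul_pow, Real.sqrt_sq (by positivity), div_eq_inv_mul]

lemma advSNR_sq_smul_one {B : Set (Vec d)} {ε s : ℝ} (hs : 0 < s)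
    (hK : IsCompact (perturbations B ε)) (h0 : (0 : Vec d) ∈ perturbations B ε) (μ : Vec d) :
    advSNR B ε μ (s ^ 2 • (1 : Matrix (Fin d) (Fin d) ℝ)) =
      2 * (Metric.infDist μ (perturbations B ε) / s) := by
  obtain ⟨z, hz, hzd⟩ := hK.exists_infDist_eq_dist ⟨0, h0⟩ μ
  -- The choice in `zOpt` is a minimizer only once one exists; a nearest point is one. Uniqueness is
  -- not needed, since only the minimal value enters.
  have hex : ∃ z, z ∈ perturbations B ε ∧ IsMinOn (fun z' =>
      matNorm (s ^ 2 • (1 : Matrix (Fin d) (Fin d) ℝ))⁻¹ (μ - z') ^ 2) (perturbations B ε) z := by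
    refine ⟨z, hz, fun w hw => ?_⟩
    simp only [Set.mem_ofPred_eq, matNorm_inv_sq_smul_one hs, ← dist_eq_norm]
    have := Metric.infDist_le_dist_of_mem (x := μ) hw
    rw [hzd] at this
    gcongr
  obtain ⟨h1, h2⟩ := Classical.epsilon_spec hex
  have h3 := h2 hz
  change _ ∈ perturbations B ε at h1
  rw [advSNR, zOpt, matNorm_inv_sq_smul_one hs]
  set y := Classical.epsilon fun z => z ∈ perturbations B ε ∧ IsMinOn (fun z' =>
      matNorm (s ^ 2 • (1 : Matrix (Fin d) (Fin d) ℝ))⁻¹ (μ - z') ^ 2) (perturbations B ε) z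
  simp only [Set.mem_ofPred_eq, matNorm_inv_sq_smul_one hs, ← dist_eq_norm] at h3
  have h4 := (sq_le_sq₀ (by positivity) (by positivity)).1 h3
  rw [div_le_div_iff_of_pos_right hs] at h4
  rw [hzd, ← dist_eq_norm]
  have := Metric.infDist_le_dist_of_mem (x := μ) h1
  rw [hzd] at this
  rw [le_antisymm h4 this]

/-- In every direction there is a mean in the model class, close to the unperturbed one. -/
lemma exists_mem_modelClass {B : Set (Vec d)} {ε s m h : ℝ} (hs : 0 < s) (hm : 0 ≤ m)
    (hh : 0 ≤ h) (hK : IsCompact (perturbations B ε)) (h0 : (0 : Vec d) ∈ perturbations B ε)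
    (hKb : ∀ x ∈ perturbations B ε, ‖x‖ ≤ h * s) {u : Vec d} (hu : ‖u‖ = 1) :
    ∃ a ∈ Set.Icc m (m + h), (s • a • u, s ^ 2 • (1 : Matrix (Fin d) (Fin d) ℝ)) ∈
      modelClass B ε (2 * m) := by
  have hcont : ContinuousOn (fun a : ℝ => Metric.infDist (s • a • u) (perturbations B ε))
      (Set.Icc m (m + h)) :=
    ((Metric.continuous_infDist_pt _).comp (by fun_prop)).continuousOn
  have hnorm {a : ℝ} (ha : 0 ≤ a) : ‖s • a • u‖ = s * a := by
    rw [norm_smul, norm_smul, hu, Real.norm_of_nonneg hs.le, Real.norm_of_nonneg ha, mul_one]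
  have hl : Metric.infDist (s • m • u) (perturbations B ε) ≤ s * m := by
    refine (Metric.infDist_le_dist_of_mem h0).trans ?_
    rw [dist_zero_right, hnorm hm]
  have hr : s * m ≤ Metric.infDist (s • (m + h) • u) (perturbations B ε) := by
    refine (Metric.le_infDist ⟨0, h0⟩).2 fun y hy => ?_
    have h1 := norm_sub_norm_le (s • (m + h) • u) y
    rw [hnorm (by linarith), ← dist_eq_norm] at h1
    linarith [hKb y hy]
  -- Intermediate values: the distance to the perturbation set is at most `s m` at length `m`,
  -- because that set contains `0`, and at least `s m` at length `m + h`, because its radius is at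
  -- most `h s`.
  obtain ⟨a, ha, hae⟩ := intermediate_value_Icc (by linarith) hcont ⟨hl, hr⟩
  refine ⟨a, ha, Matrix.PosDef.one.smul (by positivity), ?_⟩
  rw [advSNR_sq_smul_one hs hK h0]
  simp only at hae
  rw [hae, mul_div_cancel_left₀ _ hs.ne']

end ModelClass

/-! ### Robust risk against ordinary risk. -/

section RobustRisk

variable {B : Set (Vec d)} {ε s : ℝ}

lemma isoRisk_le_robustRisk (hs : 0 < s) (h0 : (0 : Vec d) ∈ perturbations B ε) (θ : Vec d)
    {f : Vec d → Label} (hf : Measurable f) :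
    (isoRisk θ fun x => f (s • x)).toReal ≤
      robustRisk B ε (s • θ) (s ^ 2 • (1 : Matrix (Fin d) (Fin d) ℝ)) f := by
  have := isProbabilityMeasure_model_smul hs θ
  have hE : MeasurableSet {p : Vec d × Label | f p.1 ≠ p.2} :=
    (measurableSet_eq_fun (by fun_prop) (by fun_prop)).compl
  have h1 : isoRisk θ (fun x => f (s • x)) =
      model (s • θ) (s ^ 2 • (1 : Matrix (Fin d) (Fin d) ℝ)) {p | f p.1 ≠ p.2} := by
    rw [model_smul hs, Measure.map_apply (by fun_prop) hE]; rfl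
  rw [h1]
  exact measureReal_mono fun p hp => ⟨0, h0, by simpa using hp⟩

lemma shiftedGaussian_inner_Icc_le {θ u : Vec d} (hu : ‖u‖ = 1) (l r : ℝ) :
    shiftedGaussian θ {x | ⟪u, x⟫ ∈ Set.Icc l r} ≤ ENNReal.ofReal (r - l) := by
  have hE : MeasurableSet {x : Vec d | ⟪u, x⟫ ∈ Set.Icc l r} :=
    measurableSet_Icc.preimage (by fun_prop)
  rw [shiftedGaussian, Measure.map_apply (by fun_prop) hE]
  have h1 : (fun x => θ + x) ⁻¹' {x : Vec d | ⟪u, x⟫ ∈ Set.Icc l r} =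
      (fun x => ⟪u, x⟫) ⁻¹' Set.Icc (l - ⟪u, θ⟫) (r - ⟪u, θ⟫) := by
    ext x
    simp only [Set.mem_preimage, Set.mem_ofPred_eq, Set.mem_Icc, inner_add_right]
    constructor <;> rintro ⟨h1, h2⟩ <;> constructor <;> linarith
  rw [h1, ← Measure.map_apply (by fun_prop) measurableSet_Icc, map_inner_stdGaussian hu]
  refine (gaussianReal_Icc_le _ _).trans_eq ?_
  congr 1; ring

/-- The attack gains on the linear classifier only in a band of rescaled width `h`, of probability
at most `h` since the normal density is at most `1`. -/
lemma optimalRisk_le {h : ℝ} (hs : 0 < s) (hh : 0 ≤ h)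
    (hKb : ∀ x ∈ perturbations B ε, ‖x‖ ≤ h * s) {u : Vec d} (hu : ‖u‖ = 1) {a : ℝ}
    (ha : 0 < a) :
    optimalRisk B ε (s • a • u) (s ^ 2 • (1 : Matrix (Fin d) (Fin d) ℝ)) ≤
      (isoRisk (a • u) (linClass (a • u))).toReal + h := by
  have := isProbabilityMeasure_model_smul hs (a • u)
  have hl := measurable_linClass u
  have hbdd : BddBelow (Set.range fun f : {f : Vec d → Label // Measurable f} =>
      robustRisk B ε (s • a • u) (s ^ 2 • (1 : Matrix (Fin d) (Fin d) ℝ)) f) :=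
    ⟨0, by rintro _ ⟨f, rfl⟩; exact measureReal_nonneg⟩
  refine (ciInf_le hbdd ⟨linClass u, hl⟩).trans ?_
  -- Inclusion in a half-space for each label suffices: monotonicity needs no measurability of the
  -- attack event.
  have hsub : {p : Vec d × Label | ∃ δ ∈ perturbations B ε, linClass u (p.1 + δ) ≠ p.2} ⊆
      {p | ((p.2 : ℤ) : ℝ) * ⟪u, p.1⟫ ≤ h * s} := by
    rintro ⟨x, y⟩ ⟨δ, hδ, hne⟩
    have h1 : |⟪u, δ⟫| ≤ h * s := by
      refine (abs_real_inner_le_norm u δ).trans ?_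
      rw [hu, one_mul]; exact hKb δ hδ
    rw [abs_le] at h1
    simp only [linClass, inner_add_right] at hne
    simp only [Set.mem_ofPred_eq]
    rcases Int.units_eq_one_or y with rfl | rfl
    · have : ¬ 0 ≤ ⟪u, x⟫ + ⟪u, δ⟫ := fun hc => hne (if_pos hc)
      simp; linarith
    · have : 0 ≤ ⟪u, x⟫ + ⟪u, δ⟫ := by
        by_contra hc; exact hne (if_neg hc)
      simp; linarith
  have hE : MeasurableSet {p : Vec d × Label | ((p.2 : ℤ) : ℝ) * ⟪u, p.1⟫ ≤ h * s} :=
    measurableSet_le (Measurable.mul ((measurable_of_countable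
      (fun y : Label => ((y : ℤ) : ℝ))).comp measurable_snd) (by fun_prop)) measurable_const
  have hE' : MeasurableSet {p : Vec d × Label | linClass u p.1 ≠ p.2} :=
    (measurableSet_eq_fun (by fun_prop) (by fun_prop)).compl
  have hF : MeasurableSet {p : Vec d × Label | ((p.2 : ℤ) : ℝ) * ⟪u, p.1⟫ ∈ Set.Icc 0 h} :=
    measurableSet_Icc.preimage (Measurable.mul ((measurable_of_countable
      (fun y : Label => ((y : ℤ) : ℝ))).comp measurable_snd) (by fun_prop))
  have hlin : linClass (a • u) = linClass u := funext fun x => linClass_smul ha u x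
  have key : model (s • a • u) (s ^ 2 • (1 : Matrix (Fin d) (Fin d) ℝ))
      {p : Vec d × Label | ((p.2 : ℤ) : ℝ) * ⟪u, p.1⟫ ≤ h * s} ≤
      isoRisk (a • u) (linClass (a • u)) + ENNReal.ofReal h := by
    rw [model_smul hs, Measure.map_apply (by fun_prop) hE, hlin, isoRisk]
    have hsub2 : (fun p : Vec d × Label => (s • p.1, p.2)) ⁻¹'
        {p : Vec d × Label | ((p.2 : ℤ) : ℝ) * ⟪u, p.1⟫ ≤ h * s} ⊆
        {p | linClass u p.1 ≠ p.2} ∪ {p | ((p.2 : ℤ) : ℝ) * ⟪u, p.1⟫ ∈ Set.Icc 0 h} := by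
      rintro ⟨x, y⟩ hp
      simp only [Set.mem_preimage, Set.mem_ofPred_eq, inner_smul_right] at hp
      have hp' : ((y : ℤ) : ℝ) * ⟪u, x⟫ ≤ h := by
        have : (((y : ℤ) : ℝ) * ⟪u, x⟫) * s ≤ h * s := by linarith
        exact le_of_mul_le_mul_right this hs
      by_cases hy : 0 ≤ ((y : ℤ) : ℝ) * ⟪u, x⟫
      · exact Or.inr ⟨hy, hp'⟩
      · refine Or.inl ?_
        simp only [Set.mem_ofPred_eq, linClass]
        rcases Int.units_eq_one_or y with rfl | rfl
        · rw [if_neg (by simpa using hy)]; decide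
        · rw [if_pos (by simp at hy; linarith)]; decide
    refine (measure_mono hsub2).trans ((measure_union_le _ _).trans (add_le_add le_rfl ?_))
    rw [isoModel_apply _ hF]
    have h1 : shiftedGaussian (a • u) {x : Vec d | (x, (1 : Label)) ∈
        {p : Vec d × Label | ((p.2 : ℤ) : ℝ) * ⟪u, p.1⟫ ∈ Set.Icc 0 h}} ≤ ENNReal.ofReal h := by
      have := shiftedGaussian_inner_Icc_le (θ := a • u) hu 0 h
      simpa using this
    have h2 : shiftedGaussian (-(a • u)) {x : Vec d | (x, (-1 : Label)) ∈
        {p : Vec d × Label | ((p.2 : ℤ) : ℝ) * ⟪u, p.1⟫ ∈ Set.Icc 0 h}} ≤ ENNReal.ofReal h := by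
      have := shiftedGaussian_inner_Icc_le (θ := -(a • u)) (u := -u) (by rw [norm_neg, hu]) 0 h
      simpa using this
    calc _ ≤ 2⁻¹ * ENNReal.ofReal h + 2⁻¹ * ENNReal.ofReal h := by gcongr
      _ = ENNReal.ofReal h := by rw [← add_mul, ENNReal.inv_two_add_inv_two, one_mul]
  refine (measureReal_mono hsub).trans ?_
  have hfin : isoRisk (a • u) (linClass (a • u)) ≠ ⊤ := measure_ne_top _ _
  have hreal := ENNReal.toReal_mono (by simp [hfin]) key
  rwa [ENNReal.toReal_add hfin (by simp), ENNReal.toReal_ofReal hh] at hreal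

/-- Disjoint events must be measurable for their probabilities to add up; this is clear for the
ordinary risk as a function of the sample, so the events are stated with it instead of the robust
risk. -/
lemma measurableSet_isoRisk_lt {Ω : Type*} [MeasurableSpace Ω] {F : Ω → Vec d → Label}
    (hF : Measurable (Function.uncurry F)) (θ : Vec d) (s : ℝ) (t : ℝ≥0∞) :
    MeasurableSet {D | isoRisk θ (fun x => F D (s • x)) < t} := by
  have hE : MeasurableSet {q : Ω × (Vec d × Label) | F q.1 (s • q.2.1) ≠ q.2.2} :=
    (measurableSet_eq_fun (hF.comp (f := fun q : Ω × (Vec d × Label) => (q.1, s • q.2.1))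
      (by fun_prop)) (by fun_prop)).compl
  exact measurableSet_lt (measurable_measure_prodMk_left (ν := isoModel θ) hE) measurable_const

/-- A small robust excess risk forces a small excess risk in the rescaled isotropic model. -/
lemma isoRisk_lt_of_excessRisk_lt {h t : ℝ} (hs : 0 < s) (hh : 0 ≤ h)
    (h0 : (0 : Vec d) ∈ perturbations B ε) (hKb : ∀ x ∈ perturbations B ε, ‖x‖ ≤ h * s)
    {u : Vec d} (hu : ‖u‖ = 1) {a : ℝ} (ha : 0 < a) {f : Vec d → Label} (hf : Measurable f)
    (hex : excessRisk B ε (s • a • u) (s ^ 2 • (1 : Matrix (Fin d) (Fin d) ℝ)) f < t) :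
    isoRisk (a • u) (fun x => f (s • x)) <
      isoRisk (a • u) (linClass (a • u)) + ENNReal.ofReal (t + h) := by
  have h1 := isoRisk_le_robustRisk hs h0 (a • u) hf
  have h2 := optimalRisk_le hs hh hKb hu ha
  rw [excessRisk] at hex
  have hfin : isoRisk (a • u) (linClass (a • u)) ≠ ⊤ := measure_ne_top _ _
  have hfin' : isoRisk (a • u) (fun x => f (s • x)) ≠ ⊤ := measure_ne_top _ _
  rw [← ENNReal.toReal_lt_toReal hfin' (by simp [hfin])]
  rw [ENNReal.toReal_add hfin (by simp)]
  linarith [le_max_left (t + h) 0, ENNReal.toReal_ofReal' (r := t + h)]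

end RobustRisk

/-! ### Packing a spherical cap. -/

section Sphere

variable {E : Type*} [NormedAddCommGroup E] [InnerProductSpace ℝ E]

/-- The graph parametrization of the unit hemisphere around `e`. -/
noncomputable def sphereChart (e w : E) : E := √(1 - ‖w‖ ^ 2) • e + w

variable {e v w : E}

lemma norm_smul_add_sq (he : ‖e‖ = 1) (hw : ⟪e, w⟫ = 0) (c : ℝ) :
    ‖c • e + w‖ ^ 2 = c ^ 2 + ‖w‖ ^ 2 := by
  rw [norm_add_sq_real, inner_smul_left, hw, norm_smul, he]
  simp

lemma norm_sphereChart (he : ‖e‖ = 1) (hw : ⟪e, w⟫ = 0) (hw1 : ‖w‖ ≤ 1) :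
    ‖sphereChart e w‖ = 1 := by
  have h := norm_smul_add_sq he hw √(1 - ‖w‖ ^ 2)
  rw [Real.sq_sqrt (by nlinarith [norm_nonneg w])] at h
  have : ‖sphereChart e w‖ ^ 2 = 1 := by rw [sphereChart, h]; ring
  exact (pow_eq_one_iff_of_nonneg (norm_nonneg _) two_ne_zero).1 this

/-- The squared distance is `2 - 2√(1 - ‖w‖²) ≤ 2‖w‖²`, and `2 ≤ (3/2)²`. -/
lemma norm_sphereChart_sub_le (he : ‖e‖ = 1) (hw : ⟪e, w⟫ = 0) (hw1 : ‖w‖ ≤ 1) :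
    ‖sphereChart e w - e‖ ≤ 3 / 2 * ‖w‖ := by
  have h := norm_smul_add_sq he hw (√(1 - ‖w‖ ^ 2) - 1)
  have e1 : sphereChart e w - e = (√(1 - ‖w‖ ^ 2) - 1) • e + w := by
    rw [sphereChart, sub_smul, one_smul]; abel
  have hs : 0 ≤ 1 - ‖w‖ ^ 2 := by nlinarith [norm_nonneg w]
  have h2 := Real.sq_sqrt hs
  have h3 : 1 - ‖w‖ ^ 2 ≤ √(1 - ‖w‖ ^ 2) := by
    apply Real.le_sqrt_of_sq_le
    nlinarith [norm_nonneg w]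
  rw [← e1] at h
  refine (sq_le_sq₀ (norm_nonneg _) (by positivity)).1 ?_
  nlinarith [sq_nonneg ‖w‖]

/-- Orthogonal projection along `e` inverts the chart and does not increase distances. -/
lemma norm_sub_le_norm_sphereChart_sub (he : ‖e‖ = 1) (hv : ⟪e, v⟫ = 0) (hw : ⟪e, w⟫ = 0) :
    ‖v - w‖ ≤ ‖sphereChart e v - sphereChart e w‖ := by
  have h := norm_smul_add_sq he (w := v - w) (by rw [inner_sub_right, hv, hw, sub_zero])
    (√(1 - ‖v‖ ^ 2) - √(1 - ‖w‖ ^ 2))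
  have e1 : sphereChart e v - sphereChart e w =
      (√(1 - ‖v‖ ^ 2) - √(1 - ‖w‖ ^ 2)) • e + (v - w) := by
    rw [sphereChart, sphereChart, sub_smul]; abel
  rw [← e1] at h
  refine (sq_le_sq₀ (norm_nonneg _) (norm_nonneg _)).1 ?_
  nlinarith [sq_nonneg (√(1 - ‖v‖ ^ 2) - √(1 - ‖w‖ ^ 2))]

/-- Keeps the packing in an open hemisphere, so that no two of its vectors are antipodal. -/
lemma inner_sphereChart_pos (he : ‖e‖ = 1) (hw : ⟪e, w⟫ = 0) (hw1 : ‖w‖ < 1) :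
    0 < ⟪e, sphereChart e w⟫ := by
  rw [sphereChart, inner_add_right, inner_smul_right, real_inner_self_eq_norm_sq, he, hw]
  have : 0 < √(1 - ‖w‖ ^ 2) := Real.sqrt_pos.2 (by nlinarith [norm_nonneg w])
  simpa using this

/-- A separated set in the hyperplane orthogonal to `e`. -/
lemma exists_separated_orthogonal [FiniteDimensional ℝ E] {q : ℕ}
    (hE : Module.finrank ℝ E = q + 1) (he : ‖e‖ = 1) {δ ρ : ℝ} (hδ : 0 < δ) (hρ : 0 < ρ) :
    ∃ T : Finset E, (∀ w ∈ T, ⟪e, w⟫ = 0 ∧ ‖w‖ ≤ ρ) ∧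
      (∀ v ∈ T, ∀ w ∈ T, v ≠ w → δ * ρ ≤ ‖v - w‖) ∧ 1 ≤ δ ^ q * T.card := by
  have hfr : Module.finrank ℝ (Submodule.span ℝ {e})ᗮ = q := by
    have : Fact (Module.finrank ℝ E = q + 1) := ⟨hE⟩
    exact Submodule.finrank_orthogonal_span_singleton (by rw [← norm_pos_iff, he]; norm_num)
  obtain ⟨T, hTR, hTs, hTc⟩ :=
    exists_separated_finset (E := (Submodule.span ℝ {e})ᗮ) hδ hρ
  rw [hfr] at hTc
  refine ⟨T.map (Function.Embedding.subtype _), ?_, ?_, by rwa [Finset.card_map]⟩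
  · intro u hu
    obtain ⟨w, hw, rfl⟩ := Finset.mem_map.1 hu
    exact ⟨Submodule.mem_orthogonal_singleton_iff_inner_right.1 w.2, hTR w hw⟩
  · intro u hu v hv huv
    obtain ⟨w, hw, rfl⟩ := Finset.mem_map.1 hu
    obtain ⟨w', hw', rfl⟩ := Finset.mem_map.1 hv
    exact hTs w hw w' hw' fun h => huv (by rw [h])

/-- A spherical cap of radius of order `ρ` contains a `δ ρ`-separated set of `δ⁻⁽ᵈ⁻¹⁾` points. -/
lemma exists_separated_unit_vectors [FiniteDimensional ℝ E] {q : ℕ}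
    (hE : Module.finrank ℝ E = q + 1) {δ ρ : ℝ} (hδ : 0 < δ) (hρ : 0 < ρ) (hρ1 : ρ ≤ 1 / 2) :
    ∃ (e : E) (T : Finset E),
      (∀ u ∈ T, ‖u‖ = 1 ∧ ‖u - e‖ ≤ 3 / 2 * ρ ∧ 0 < ⟪e, u⟫) ∧
      (∀ u ∈ T, ∀ v ∈ T, u ≠ v → δ * ρ ≤ ‖u - v‖) ∧ 1 ≤ δ ^ q * T.card := by
  classical
  have : Nontrivial E := Module.nontrivial_of_finrank_pos (R := ℝ) (by omega)
  obtain ⟨e, he1⟩ := exists_norm_eq E zero_le_one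
  obtain ⟨T, hT, hTs, hTc⟩ := exists_separated_orthogonal hE he1 hδ hρ
  have hsep {v} (hv : v ∈ T) {w} (hw : w ∈ T) (hvw : v ≠ w) :
      δ * ρ ≤ ‖sphereChart e v - sphereChart e w‖ :=
    (hTs v hv w hw hvw).trans (norm_sub_le_norm_sphereChart_sub he1 (hT v hv).1 (hT w hw).1)
  refine ⟨e, T.image (sphereChart e), ?_, ?_, ?_⟩
  · intro u hu
    obtain ⟨w, hw, rfl⟩ := Finset.mem_image.1 hu
    obtain ⟨hw0, hw1⟩ := hT w hw
    refine ⟨norm_sphereChart he1 hw0 (by linarith), ?_,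
      inner_sphereChart_pos he1 hw0 (by linarith)⟩
    exact (norm_sphereChart_sub_le he1 hw0 (by linarith)).trans (by linarith)
  · intro u hu v hv huv
    obtain ⟨w, hw, rfl⟩ := Finset.mem_image.1 hu
    obtain ⟨w', hw', rfl⟩ := Finset.mem_image.1 hv
    exact hsep hw hw' fun h => huv (by rw [h])
  · rw [Finset.card_image_of_injOn]
    · exact hTc
    · intro v hv w hw hvw
      by_contra hne
      have h1 := hsep hv hw hne
      rw [hvw, sub_self, norm_zero] at h1
      exact absurd h1 (not_le.2 (by positivity))

end Sphere

/-! ### The minimax argument. -/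

lemma SqDom.mono {X : Type*} [MeasurableSpace X] {C D : ℝ≥0∞} {P Q : Measure X}
    (h : SqDom C P Q) (hCD : C ≤ D) : SqDom D P Q :=
  fun f hf => (h f hf).trans (by gcongr)

lemma sqDom_sampleLaw {d : ℕ} (n : ℕ) {s : ℝ} (hs : 0 < s) (θ θ₀ : Vec d) :
    SqDom (ENNReal.ofReal (Real.exp (n * ‖θ - θ₀‖ ^ 2)))
      (sampleLaw n (s • θ) (s ^ 2 • (1 : Matrix (Fin d) (Fin d) ℝ)))
      (sampleLaw n (s • θ₀) (s ^ 2 • (1 : Matrix (Fin d) (Fin d) ℝ))) := by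
  have := isProbabilityMeasure_model_smul hs θ
  have := isProbabilityMeasure_model_smul hs θ₀
  have h : SqDom (ENNReal.ofReal (Real.exp (‖θ - θ₀‖ ^ 2)))
      (model (s • θ) (s ^ 2 • (1 : Matrix (Fin d) (Fin d) ℝ)))
      (model (s • θ₀) (s ^ 2 • (1 : Matrix (Fin d) (Fin d) ℝ))) := by
    rw [model_smul hs, model_smul hs]
    exact (sqDom_isoModel θ θ₀).map (by fun_prop)
  have h2 := h.pi n
  rwa [← ENNReal.ofReal_pow (Real.exp_pos _).le, ← Real.exp_nat_mul] at h2

/-- The separation of the excess risks at `m = r / 2`, for a packing of relative radius `δ` and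
`x² = (d - 1) / n`. -/
noncomputable def excessGap (m x δ : ℝ) : ℝ :=
  Real.exp (-((m ^ 2 + 1) / 2)) * m * (wedgeConst / 8) * (δ * (x / (2 * (1 + m)))) ^ 2

lemma excessGap_pos {m x δ : ℝ} (hm : 0 < m) (hx : 0 < x) (hδ : 0 < δ) : 0 < excessGap m x δ := by
  have := wedgeConst_pos
  unfold excessGap
  positivity

lemma not_isoRisk_lt_of_isoRisk_lt {d : ℕ} {u v : Vec d} (hu : ‖u‖ = 1) (hv : ‖v‖ = 1)
    (huv : u ≠ v) (huv' : u + v ≠ 0) {m m' a b G : ℝ} (hm : 0 < m) (ha : m ≤ a) (ha' : a ≤ m')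
    (hb : m ≤ b) (hb' : b ≤ m') (hG : 0 ≤ G)
    (hGle : G ≤ Real.exp (-(m' ^ 2 / 2)) * m * (wedgeConst / 8) * ‖u - v‖ ^ 2)
    {g : Vec d → Label} (hg : Measurable g)
    (h1 : isoRisk (a • u) g < isoRisk (a • u) (linClass (a • u)) + ENNReal.ofReal (G / 2)) :
    ¬ isoRisk (b • v) g < isoRisk (b • v) (linClass (b • v)) + ENNReal.ofReal (G / 2) := by
  intro h2
  have hge := isoRisk_add_isoRisk_ge hu hv huv huv' hm ha ha' hb hb' hg
  have hlt := ENNReal.add_lt_add h1 h2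
  rw [add_add_add_comm, ← ENNReal.ofReal_add (by positivity) (by positivity), add_halves] at hlt
  exact absurd (hge.trans_lt hlt)
    (not_lt.2 (add_le_add le_rfl (ENNReal.ofReal_le_ofReal hGle)))

/-- The minimax lower bound for a fixed adversarial signal-to-noise ratio `2 m`. -/
theorem exists_modelClass_sampleLaw_le {d n : ℕ} (hd : 2 ≤ d) (hn : d ≤ n) {B : Set (Vec d)}
    (hne : B.Nonempty) (hcl : IsClosed B) (hb : Bornology.IsBounded B) (hc : Convex ℝ B)
    (hsym : ∀ x ∈ B, -x ∈ B) {ε : ℝ} (hε : 0 ≤ ε) {m : ℝ} (hm : 0 < m)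
    {fhat : (Fin n → Vec d × Label) → Vec d → Label} (hf : Measurable (Function.uncurry fhat))
    {β : ℝ} (hβ : 0 < β) (hβ1 : β ≤ 1) :
    ∃ θ ∈ modelClass B ε (2 * m), sampleLaw n θ.1 θ.2
      {D | excessRisk B ε θ.1 θ.2 (fhat D) <
        excessGap m √((d - 1 : ℕ) / n) (Real.exp (-1) * β ^ 2) / 4} ≤ ENNReal.ofReal β := by
  set q := d - 1 with hq
  have hq1 : 1 ≤ q := by omega
  set x := √((q : ℝ) / n) with hx
  -- At least `δ^{-q}` packing points must beat the factor `e^q` and leave `β²`.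
  set δ := Real.exp (-1) * β ^ 2 with hδ
  have hδ0 : 0 < δ := by positivity
  have hn0 : (0 : ℝ) < n := by exact_mod_cast (by omega : 0 < n)
  have hq0 : (0 : ℝ) < q := by exact_mod_cast hq1
  have hx0 : 0 < x := Real.sqrt_pos.2 (by positivity)
  have hx2 : x ^ 2 = q / n := Real.sq_sqrt (by positivity)
  have hx1 : x ≤ 1 := by
    rw [hx, Real.sqrt_le_one]
    rw [div_le_one hn0]; exact_mod_cast (by omega : q ≤ n)
  set G := excessGap m x δ with hG
  have hG0 : 0 < G := excessGap_pos hm hx0 hδ0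
  -- The factor `1 + m` gives both `ρ ≤ 1/2` and `m ρ ≤ x/2`, since means of length about `m` move
  -- by `m` times the change of direction.
  set ρ := x / (2 * (1 + m)) with hρ
  have hρ0 : 0 < ρ := by positivity
  have hρ1 : ρ ≤ 1 / 2 := by
    rw [hρ, div_le_div_iff₀ (by positivity) two_pos]; nlinarith
  have hmρ : m * ρ ≤ x / 2 := by
    rw [hρ, mul_div_assoc', div_le_div_iff₀ (by positivity) two_pos]; nlinarith
  -- The three bounds keep `(m + τ)² ≤ m² + 1`, the length change within `x/4`, and the robustness
  -- error within `G/4`.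
  set τ := min (1 / (2 * m + 1)) (min (x / 4) (G / 4)) with hτ
  have hτ0 : 0 < τ := by positivity
  have hτ1 : τ * (2 * m + 1) ≤ 1 := by
    rw [← le_div_iff₀ (by positivity)]; exact min_le_left _ _
  have hτx : τ ≤ x / 4 := (min_le_right _ _).trans (min_le_left _ _)
  have hτG : τ ≤ G / 4 := (min_le_right _ _).trans (min_le_right _ _)
  have hm' : (m + τ) ^ 2 ≤ m ^ 2 + 1 := by
    have : τ ≤ 1 := by nlinarith
    nlinarith
  -- the scale
  have hB0 := zero_mem_of_convex_of_symm hne hc hsym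
  have hK0 : (0 : Vec d) ∈ perturbations B ε := zero_mem_perturbations hB0
  have hK := isCompact_perturbations hcl hb hc hB0 hε
  obtain ⟨R, hR0, hR⟩ := hK.isBounded.exists_pos_norm_le
  set s := R / τ with hs
  have hs0 : 0 < s := by positivity
  have hKb : ∀ y ∈ perturbations B ε, ‖y‖ ≤ τ * s := by
    intro y hy
    rw [hs, mul_div_cancel₀ _ hτ0.ne']; exact hR y hy
  -- the packing
  obtain ⟨e, T, hT, hTs, hTc⟩ := exists_separated_unit_vectors (E := Vec d) (q := q)
    (by simp; omega) hδ0 hρ0 hρ1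
  have hT0 : T.Nonempty := by
    rw [Finset.nonempty_iff_ne_empty]; rintro rfl; simp at hTc; linarith
  have hex (u : Vec d) : ∃ a : ℝ, u ∈ T → a ∈ Set.Icc m (m + τ) ∧
      (s • a • u, s ^ 2 • (1 : Matrix (Fin d) (Fin d) ℝ)) ∈ modelClass B ε (2 * m) := by
    by_cases hu : u ∈ T
    · obtain ⟨a, h1, h2⟩ := exists_mem_modelClass hs0 hm.le hτ0.le hK hK0 hKb (hT u hu).1
      exact ⟨a, fun _ => ⟨h1, h2⟩⟩
    · exact ⟨0, fun h => absurd h hu⟩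
  choose a ha using hex
  -- the events
  let A (u : Vec d) : Set (Fin n → Vec d × Label) :=
    {D | isoRisk (a u • u) (fun y => fhat D (s • y)) <
      isoRisk (a u • u) (linClass (a u • u)) + ENNReal.ofReal (G / 2)}
  have hAm (u) : MeasurableSet (A u) := measurableSet_isoRisk_lt hf _ _ _
  have hfD (D) : Measurable (fhat D) := hf.comp measurable_prodMk_left
  have hdisj : (T : Set (Vec d)).PairwiseDisjoint A := by
    intro u hu v hv huv
    rw [Function.onFun, Set.disjoint_left]
    intro D hDu hDv
    obtain ⟨hu1, -, hu0⟩ := hT u hu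
    obtain ⟨hv1, -, hv0⟩ := hT v hv
    have hsep := hTs u hu v hv huv
    have hadd : u + v ≠ 0 := by
      intro h
      have h3 : ⟪e, u + v⟫ = 0 := by rw [h, inner_zero_right]
      rw [inner_add_right] at h3
      linarith
    refine not_isoRisk_lt_of_isoRisk_lt hu1 hv1 huv hadd hm (ha u hu).1.1 (ha u hu).1.2
      (ha v hv).1.1 (ha v hv).1.2 hG0.le ?_ ((hfD D).comp (by fun_prop)) hDu hDv
    have := wedgeConst_pos
    rw [hG, excessGap]
    gcongr
  -- the change of measure
  have := isProbabilityMeasure_model_smul hs0 (m • e)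
  have hQ : IsProbabilityMeasure (sampleLaw n (s • m • e)
      (s ^ 2 • (1 : Matrix (Fin d) (Fin d) ℝ))) := by
    unfold sampleLaw; infer_instance
  have hdom : ∀ u ∈ T, SqDom (ENNReal.ofReal (Real.exp q))
      (sampleLaw n (s • a u • u) (s ^ 2 • (1 : Matrix (Fin d) (Fin d) ℝ)))
      (sampleLaw n (s • m • e) (s ^ 2 • (1 : Matrix (Fin d) (Fin d) ℝ))) := by
    intro u hu
    refine (sqDom_sampleLaw n hs0 (a u • u) (m • e)).mono (ENNReal.ofReal_le_ofReal
      (Real.exp_le_exp.2 ?_))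
    obtain ⟨hu1, h2, -⟩ := hT u hu
    obtain ⟨⟨ha1, ha2⟩, -⟩ := ha u hu
    -- Length contributes at most `τ ≤ x/4`, direction at most `(3/2) m ρ ≤ 3x/4`.
    have h1 : ‖a u • u - m • e‖ ≤ x := by
      have e1 : a u • u - m • e = (a u - m) • u + m • (u - e) := by
        rw [sub_smul, smul_sub]; abel
      rw [e1]
      refine (norm_add_le _ _).trans ?_
      rw [norm_smul, norm_smul, hu1, mul_one, Real.norm_of_nonneg (by linarith),
        Real.norm_of_nonneg hm.le]
      nlinarith
    calc (n : ℝ) * ‖a u • u - m • e‖ ^ 2 ≤ n * x ^ 2 := by gcongr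
      _ = (q : ℝ) := by rw [hx2]; field_simp
  obtain ⟨u, hu, hle⟩ := exists_measure_le_of_pairwiseDisjoint hT0 hdom (fun u _ => hAm u) hdisj
  obtain ⟨⟨ha1, -⟩, haM⟩ := ha u hu
  refine ⟨_, haM, ?_⟩
  have hsub : {D | excessRisk B ε (s • a u • u) (s ^ 2 • (1 : Matrix (Fin d) (Fin d) ℝ))
      (fhat D) < G / 4} ⊆ A u := by
    intro D hD
    -- Here `G/4 + τ ≤ G/2`, the threshold defining `A u`.
    refine (isoRisk_lt_of_excessRisk_lt hs0 hτ0.le hK0 hKb (hT u hu).1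
      (hm.trans_le ha1) (hfD D) hD).trans_le ?_
    gcongr
    linarith
  refine (measure_mono hsub).trans ?_
  have hcard : (0 : ℝ) < T.card := by exact_mod_cast hT0.card_pos
  have hfin : ENNReal.ofReal (Real.exp q) / T.card ≤ ENNReal.ofReal β ^ 2 := by
    rw [← ENNReal.ofReal_natCast, ← ENNReal.ofReal_div_of_pos hcard, ← ENNReal.ofReal_pow hβ.le]
    apply ENNReal.ofReal_le_ofReal
    rw [div_le_iff₀ hcard]
    -- `β^{2q} ≤ β²` uses `β ≤ 1` and `q ≥ 1`.
    have h1 : δ ^ q ≤ Real.exp (-q) * β ^ 2 := by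
      rw [hδ, mul_pow, ← Real.exp_nat_mul]
      gcongr
      · simp
      · exact pow_le_of_le_one (by positivity) (pow_le_one₀ hβ.le hβ1) (by omega)
    have h2 : 1 ≤ Real.exp (-q) * β ^ 2 * T.card := hTc.trans (by gcongr)
    calc Real.exp q ≤ Real.exp q * (Real.exp (-q) * β ^ 2 * T.card) :=
          le_mul_of_one_le_right (Real.exp_pos _).le h2
      _ = (Real.exp q * Real.exp (-q)) * (β ^ 2 * T.card) := by ring
      _ = β ^ 2 * T.card := by rw [← Real.exp_add]; simp
  exact (ENNReal.pow_le_pow_left_iff two_ne_zero).1 (hle.trans hfin)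

end AdvRobust

theorem mainTheorem2 :
    ∃ η : ℝ → ℝ, Tendsto η atTop (𝓝 0) ∧
      ∀ r₀ : ℝ, 0 < r₀ → ∀ α : ℝ, 0 < α → ∃ c : ℝ, 0 < c ∧
        ∀ (d n : ℕ), 2 ≤ d → d ≤ n →
        ∀ (B : Set (AdvRobust.Vec d)), B.Nonempty → IsClosed B → Bornology.IsBounded B →
          Convex ℝ B → (∀ x ∈ B, -x ∈ B) →
        ∀ (ε : ℝ), 0 ≤ ε → ∀ (r : ℝ), r₀ ≤ r →
        ∀ (fhat : (Fin n → AdvRobust.Vec d × AdvRobust.Label) →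
            AdvRobust.Vec d → AdvRobust.Label),
          Measurable (Function.uncurry fhat) →
        ∃ θ ∈ AdvRobust.modelClass B ε r,
          AdvRobust.sampleLaw n θ.1 θ.2
              {D | AdvRobust.excessRisk B ε θ.1 θ.2 (fhat D) <
                c * (Real.exp (-(1 / 8 + η r) * r ^ 2) * ((d : ℝ) / (n : ℝ)))} ≤
            ENNReal.ofReal α := by
  -- With `η r = 1/r` the slack is `e^{-r} = e^{-2m}`, which absorbs the polynomial loss `(1 + m)²`.
  refine ⟨fun r => r⁻¹, tendsto_inv_atTop_zero, fun r₀ hr₀ α hα => ?_⟩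
  set β := min α 1 with hβ
  have hβ0 : 0 < β := by positivity
  set δ := Real.exp (-1) * β ^ 2 with hδ
  have hδ0 : 0 < δ := by positivity
  have hw := AdvRobust.wedgeConst_pos
  -- `512 = 128 · 2 · 2`: `128` from `excessGap / 4`, one `2` from `m ≥ r₀/2`, one from `d - 1 ≥
  -- d/2`.
  refine ⟨Real.exp (-(1 / 2)) * AdvRobust.wedgeConst * δ ^ 2 * r₀ / 512, by positivity, ?_⟩
  intro d n hd hn B hne hcl hb hc hsym ε hε r hr fhat hf
  have hr0 : 0 < r := hr₀.trans_le hr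
  obtain ⟨m, rfl⟩ : ∃ m, r = 2 * m := ⟨r / 2, by ring⟩
  have hm : 0 < m := by linarith
  obtain ⟨θ, hθ, hle⟩ := AdvRobust.exists_modelClass_sampleLaw_le hd hn hne hcl hb hc hsym hε hm hf
    hβ0 (min_le_right _ _)
  refine ⟨θ, hθ, le_trans (measure_mono (Set.ofPred_subset_ofPred.2 fun D hD => lt_of_lt_of_le hD ?_))
    (hle.trans (ENNReal.ofReal_le_ofReal (min_le_left _ _)))⟩
  have hn0 : (0 : ℝ) < n := by exact_mod_cast (by omega : 0 < n)
  have e1 : -(1 / 8 + (2 * m)⁻¹) * (2 * m) ^ 2 = -(m ^ 2 / 2) + -(2 * m) := by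
    field_simp; ring
  have e2 : AdvRobust.excessGap m √((d - 1 : ℕ) / n) δ / 4 =
      Real.exp (-(1 / 2)) * AdvRobust.wedgeConst * δ ^ 2 / 128 * Real.exp (-(m ^ 2 / 2)) *
        (m / (1 + m) ^ 2) * (((d - 1 : ℕ) : ℝ) / n) := by
    have : Real.exp (-((m ^ 2 + 1) / 2)) = Real.exp (-(1 / 2)) * Real.exp (-(m ^ 2 / 2)) := by
      rw [← Real.exp_add]; ring_nf
    rw [AdvRobust.excessGap, mul_pow, div_pow, Real.sq_sqrt (by positivity), this]
    field_simp; ring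
  have h1 : r₀ / 2 * Real.exp (-(2 * m)) ≤ m / (1 + m) ^ 2 := by
    have h2 : (1 + m) ^ 2 ≤ Real.exp (2 * m) := by
      have := Real.add_one_le_exp m
      calc (1 + m) ^ 2 ≤ Real.exp m ^ 2 := by gcongr; linarith
        _ = _ := by rw [← Real.exp_nat_mul]; simp
    rw [Real.exp_neg, ← div_eq_mul_inv]
    gcongr
    linarith
  have h3 : (d : ℝ) / n / 2 ≤ ((d - 1 : ℕ) : ℝ) / n := by
    rw [div_right_comm]
    gcongr
    rw [Nat.cast_sub (by omega)]
    have : (2 : ℝ) ≤ d := by exact_mod_cast hd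
    push_cast; linarith
  rw [e1, e2, Real.exp_add]
  calc _ = Real.exp (-(1 / 2)) * AdvRobust.wedgeConst * δ ^ 2 / 128 * Real.exp (-(m ^ 2 / 2)) *
        (r₀ / 2 * Real.exp (-(2 * m))) * ((d : ℝ) / n / 2) := by ring
    _ ≤ _ := by gcongr
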